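/- Let $p$ be an odd prime and let $N=p$ or $N=2p$. An *index set* is a function $M:\mathbb Z/N\mathbb Z\to\mathbb Z_{\ge 0}$ with $\sum_k M_k=N$ and $\sum_k kM_k\equiv 0 \pmod N$. For $(a,b)\in (\mathbb Z/N\mathbb Z)^+\times(\mathbb Z/N\mathbb Z)^\times$ define the symmetry operation $(a,b)*M$ by $((a,b)*M)_k=M_{kb^{-1}-a}$. The *super-multiplet* of an index set $M$ is $\{(a,b)*M : (a,b)\in(\mathbb Z/N\mathbb Z)^+\times(\mathbb Z/N\mathbb Z)^\times\}$; let $n_{SM}(N)$ be the number of different super-multiplets. Let $\phi$ be Euler's totient function. (i) Let $H_N=(\mathbb Z/N\mathbb Z)^+\times(\mathbb Z/N\mathbb Z)^\times$ be the direct product group. For each subgroup $S\subseteq H_N$ choose a set $T_S$ of generators of $S$, consisting of a single element whenever $S$ is cyclic, and let $K(S)$ be the number of index sets $M$ with $g*M=M$ for all $g\in T_S$. Then, whatever the choices, with the sum over all subgroups $S$ of $H_N$, $$n_{SM}(N)=\frac{1}{N\phi(N)}\sum_{S\subseteq H_N}\phi(|S|)\,K(S).$$ (ii) Let $G_N$ be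 the group, under composition, of all the permutations $k\mapsto kb^{-1}-a$ of $\mathbb Z/N\mathbb Z$, with $a\in\mathbb Z/N\mathbb Z$ and $b\in(\mathbb Z/N\mathbb Z)^\times$. For a subgroup $S\subseteq G_N$ let $K'(S)$ be the number of index sets $M$ with $M\circ\sigma=M$ for every $\sigma\in S$. Then, with the sum over all cyclic subgroups $S$ of $G_N$, $$n_{SM}(N)=\frac{1}{N\phi(N)}\sum_{S\subseteq G_N,\ S\text{ cyclic}}\phi(|S|)\,K'(S).$$ (iii) If $N=p$, then $$n_{SM}(p)=\frac{1}{p(p-1)}\left\{\frac{1}{2p}\binom{2p}{p}+\frac{p^2-1}{p}+p\sum_{\substack{m\mid (p-1)\\ m<p-1}}\phi\!\left(\frac{p-1}{m}\right)\binom{2m}{m}\right\}.$$ (iv) If $N=2p$, then $$n_{SM}(2p)=\frac{1}{2p(p-1)}\left\{\frac{1}{4p}\binom{4p}{2p}+\frac{4p^2+1}{4p}\binom{2p}{p}+\frac{2(p^2-1)}{p}+p\sum_{\substack{m\mid (p-1)\\ m<(p-1)/2}}\phi\!\left(\frac{p-1}{m}\right)\left[\left(\frac{p+4m+1}{2m+1}-\frac{1-(-1)^{(p-1)/m}}{4}\right)\binom{4m}{2m}+\frac{1-(-1)^{(p-1)/m}}{4}\binom{2m}{m}\right]\right\}.$$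 -/

import Mathlib

/-- A multiplicity index set `[M_0, …, M_{N-1}]` (subscripts read modulo `N`): the multiplicities
sum to `N`, and `∑ k * M_k ≡ 0 (mod N)`. -/
def IsIndexSet (N : ℕ) [NeZero N] (M : ZMod N → ℕ) : Prop :=
  ∑ k, M k = N ∧ ∑ k, k * (M k : ZMod N) = 0

/-- The direct product `(ℤ/Nℤ)⁺ × (ℤ/Nℤ)ˣ`, with `(a, b) * (c, d) = (a + c, b * d)`. -/
abbrev DirectProd (N : ℕ) : Type := Multiplicative (ZMod N) × (ZMod N)ˣ

/-- The permutation `k ↦ k * b⁻¹ - a` of the subscripts attached to the pair `(a, b)`. -/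
def subscriptPerm (N : ℕ) (h : DirectProd N) : Equiv.Perm (ZMod N) where
  toFun k := k * ((h.2⁻¹ : (ZMod N)ˣ) : ZMod N) - Multiplicative.toAdd h.1
  invFun k := (k + Multiplicative.toAdd h.1) * (h.2 : ZMod N)
  left_inv k := by simp
  right_inv k := by simp

/-- The symmetry operation `(a, b) * [M]`, whose entry at `k` is `M_{k b⁻¹ - a}`. -/
def symmOp (N : ℕ) (h : DirectProd N) (M : ZMod N → ℕ) : ZMod N → ℕ :=
  fun k => M (subscriptPerm N h k)

/-- The super-multiplet of `[M]`: all index sets `(a, b) * [M]`. -/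
def superMultiplet (N : ℕ) (M : ZMod N → ℕ) : Set (ZMod N → ℕ) :=
  Set.range fun h : DirectProd N => symmOp N h M

/-- The number `n_SM(N)` of super-multiplets. -/
noncomputable def numSuperMultiplets (N : ℕ) [NeZero N] : ℕ :=
  Set.ncard {O : Set (ZMod N → ℕ) | ∃ M, IsIndexSet N M ∧ O = superMultiplet N M}

/-- The number of index sets `[M]` that are invariant under `(a, b)` for every pair `(a, b)`
in `T`. -/
noncomputable def numInvariant (N : ℕ) [NeZero N] (T : Set (DirectProd N)) : ℕ :=
  Set.ncard {M : ZMod N → ℕ | IsIndexSet N M ∧ ∀ h ∈ T, symmOp N h M = M}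

/-- The symmetry group, as the group (under composition) of all the subscript permutations
`k ↦ k * b⁻¹ - a`. -/
def symmGroup (N : ℕ) : Subgroup (Equiv.Perm (ZMod N)) where
  carrier := Set.range (subscriptPerm N)
  one_mem' := ⟨1, by ext k; simp [subscriptPerm]⟩
  mul_mem' := by
    rintro _ _ ⟨⟨a, b⟩, rfl⟩ ⟨⟨c, d⟩, rfl⟩
    refine ⟨(Multiplicative.ofAdd
      (Multiplicative.toAdd c * ((b⁻¹ : (ZMod N)ˣ) : ZMod N) + Multiplicative.toAdd a),
        d * b), ?_⟩
    refine Equiv.ext fun k => ?_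
    simp only [subscriptPerm, Equiv.coe_fn_mk, Equiv.Perm.coe_mul, Function.comp_apply,
      mul_inv_rev, Units.val_mul, toAdd_ofAdd]
    ring
  inv_mem' := by
    rintro _ ⟨⟨a, b⟩, rfl⟩
    refine ⟨(Multiplicative.ofAdd (-(Multiplicative.toAdd a * (b : ZMod N))), b⁻¹), ?_⟩
    refine Equiv.ext fun k => ?_
    rw [Equiv.Perm.eq_inv_iff_eq]
    simp [subscriptPerm, add_mul]

/-- `K(S)`: the number of index sets `[M]` that are invariant under every element of a group `S`
of subscript permutations. -/
noncomputable def numInvariantSubgroup (N : ℕ) [NeZero N]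
    (S : Subgroup (Equiv.Perm (ZMod N))) : ℕ :=
  Set.ncard {M : ZMod N → ℕ | IsIndexSet N M ∧ ∀ σ ∈ S, M ∘ σ = M}

/-!
Burnside's lemma turns the number of super-multiplets into `1 / (N φ(N))` times the sum, over all
pairs `(a, b)`, of the number of index sets fixed by `k ↦ k b⁻¹ - a`. Grouping the elements of the
symmetry group by the cyclic subgroup they generate gives the sum over cyclic subgroups of
permutations (`sum_comp_zpowers`).

The pairs compose differently from the permutations they index, so the sum over subgroups of the
direct product needs an extra argument. The number of fixed index sets of a pair depends only on
the parity of `a` (when `N = 2p`), on whether `a ≡ 0 (mod p)`, and on the order of `b`; these agree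
for two generators of the same subgroup (`eq_of_zpowers_eq`). A non-cyclic subgroup exists only
for `N = 2p`, and its generators include a pair with `a` odd. Such a pair exchanges even and odd
residues, so a fixed multiplicity function has mass `p` on the odd residues; as `p` is odd,
`∑ k * M k` is odd and there is no fixed index set (`symmOp_ne_of_parityHom_ne_one`).

For the explicit formulas, an index set modulo `2p` is split into two functions on `ZMod p`, its
restrictions to odd and to even residues, the first having even total mass. For `a` even a pair
acts on both by the same affine map of `ZMod p`. The fixed functions on `ZMod p`, counted by total
mass, have the generating functions
* `1 / (1 - X) ^ p` for the identity,
* `1 / (1 - X ^ p)` for a nontrivial translation,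
* `1 / ((1 - X) * (1 - X ^ d) ^ m)` with `m = (p - 1) / d`, for a multiplier of order `d > 1`, since
  such a map has one fixed point and `m` orbits of length `d` (`card_fixFinset_of_ne_one`).

The condition `∑ k * M k ≡ 0 (mod p)` is automatic except for the identity. There it is imposed by
averaging over additive characters, and each nontrivial character contributes
`∏ 1 / (1 - ζ ^ k X) = 1 / (1 - X ^ p)` (`mk_momentSum_of_ne_zero`). The condition that the odd
residues have even mass is imposed by averaging `f(X) f(X)` and `f(-X) f(X)`
(`two_mul_sum_antidiagonal_even`). Reading off coefficients and summing over `(a, b)`, with `φ(d)`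
multipliers of each order `d ∣ p - 1` and `p` translations for each, gives the formulas.
-/

/-! ### Orbit counting over cyclic subgroups -/

theorem card_zpowers_eq {Γ : Type*} [Group Γ] [Fintype Γ] [DecidableEq (Subgroup Γ)]
    (S : Subgroup Γ) (hS : IsCyclic S) :
    (Finset.univ.filter fun g : Γ => Subgroup.zpowers g = S).card = Nat.totient (Nat.card S) := by
  classical
  have : Fintype S := Fintype.ofFinite S
  rw [← IsCyclic.card_orderOf_eq_totient (α := S) (d := Nat.card S)
    (by rw [Nat.card_eq_fintype_card])]
  symm
  refine Finset.card_bij (fun x _ => (x : Γ)) ?_ ?_ ?_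
  · intro x hx
    simp only [Finset.mem_filter, Finset.mem_univ, true_and] at hx ⊢
    refine Subgroup.eq_of_le_of_card_ge (by simp) ?_
    rw [Nat.card_zpowers, Subgroup.orderOf_coe, hx]
  · intro x _ y _ h
    exact Subtype.ext h
  · intro g hg
    simp only [Finset.mem_filter, Finset.mem_univ, true_and] at hg
    have hmem : g ∈ S := hg ▸ Subgroup.mem_zpowers g
    refine ⟨⟨g, hmem⟩, ?_, rfl⟩
    simp only [Finset.mem_filter, Finset.mem_univ, true_and, Subgroup.orderOf_mk]
    subst hg
    rw [Nat.card_zpowers]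

/-- Every element generates exactly one cyclic subgroup, and a cyclic group of order `n` has
`φ n` generators. -/
theorem sum_comp_zpowers {Γ : Type*} [Group Γ] [Fintype Γ] (c : Subgroup Γ → ℚ) :
    ∑ g : Γ, c (Subgroup.zpowers g) =
      ∑ᶠ (S : Subgroup Γ) (_ : IsCyclic S), (Nat.totient (Nat.card S) : ℚ) * c S := by
  classical
  have : Fintype (Subgroup Γ) := Fintype.ofFinite _
  rw [finsum_eq_sum_of_fintype, ← Finset.sum_fiberwise _ (fun g : Γ => Subgroup.zpowers g)]
  refine Finset.sum_congr rfl fun S _ => ?_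
  rw [Finset.sum_congr rfl (g := fun _ => c S) (fun g hg => by rw [(Finset.mem_filter.1 hg).2]),
    finsum_eq_if]
  split_ifs with h
  · rw [Finset.sum_const, card_zpowers_eq S h, nsmul_eq_mul]
  · refine Finset.sum_eq_zero fun g hg => ?_
    refine absurd ?_ h
    rw [← (Finset.mem_filter.1 hg).2]
    infer_instance

theorem subscriptPerm_injective (N : ℕ) : Function.Injective (subscriptPerm N) := by
  rintro ⟨a, b⟩ ⟨c, d⟩ h
  have h0 : subscriptPerm N (a, b) 0 = subscriptPerm N (c, d) 0 := by rw [h]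
  have h1 : subscriptPerm N (a, b) 1 = subscriptPerm N (c, d) 1 := by rw [h]
  simp only [subscriptPerm, Equiv.coe_fn_mk, zero_mul, zero_sub, neg_inj, one_mul,
    EmbeddingLike.apply_eq_iff_eq] at h0 h1
  subst h0
  have h2 := Units.ext (sub_left_injective h1)
  rw [inv_inj] at h2
  rw [h2]

/-! ### Burnside's lemma for the symmetry group -/

section Burnside

variable (N : ℕ) [NeZero N]

theorem finite_setOf_isIndexSet : {M : ZMod N → ℕ | IsIndexSet N M}.Finite := by
  refine (Finset.piAntidiag Finset.univ N).finite_toSet.subset fun M hM => ?_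
  simpa using hM.1

theorem isIndexSet_comp_subscriptPerm (h : DirectProd N) (M : ZMod N → ℕ)
    (hM : IsIndexSet N M) : IsIndexSet N (M ∘ subscriptPerm N h) := by
  obtain ⟨h1, h2⟩ := hM
  have e : ∀ k, (subscriptPerm N h).symm k = (k + Multiplicative.toAdd h.1) * (h.2 : ZMod N) :=
    fun _ => rfl
  refine ⟨?_, ?_⟩
  · exact (Equiv.sum_comp (subscriptPerm N h) M).trans h1
  · rw [← Equiv.sum_comp (subscriptPerm N h).symm]
    have h3 : ∑ k, (M k : ZMod N) = 0 := by
      have := congrArg (Nat.cast : ℕ → ZMod N) h1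
      simpa using this
    simp only [Function.comp_apply, Equiv.apply_symm_apply]
    simp only [e]
    calc _ = (h.2 : ZMod N) * ∑ k, k * (M k : ZMod N)
          + Multiplicative.toAdd h.1 * (h.2 : ZMod N) * ∑ k, (M k : ZMod N) := by
          rw [Finset.mul_sum, Finset.mul_sum, ← Finset.sum_add_distrib]
          exact Finset.sum_congr rfl fun k _ => by ring
      _ = 0 := by rw [h2, h3]; simp

/-- The symmetry group acts on index sets by `σ • M = M ∘ σ⁻¹`. -/
instance symmGroupAction : MulAction (symmGroup N) {M : ZMod N → ℕ // IsIndexSet N M} where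
  smul σ M := ⟨M.1 ∘ (σ⁻¹ : symmGroup N).1, by
    obtain ⟨h, hh⟩ := (σ⁻¹ : symmGroup N).2
    rw [← hh]
    exact isIndexSet_comp_subscriptPerm N h M.1 M.2⟩
  one_smul M := Subtype.ext <| funext fun k => by
    change M.1 ((1⁻¹ : symmGroup N).1 k) = M.1 k
    simp
  mul_smul σ τ M := Subtype.ext <| funext fun k => by
    change M.1 (((σ * τ)⁻¹ : symmGroup N).1 k) =
      M.1 ((τ⁻¹ : symmGroup N).1 ((σ⁻¹ : symmGroup N).1 k))
    simp

theorem symmGroupAction_coe (σ : symmGroup N) (M : {M : ZMod N → ℕ // IsIndexSet N M}) :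
    (σ • M).1 = M.1 ∘ (σ⁻¹ : symmGroup N).1 := rfl

theorem superMultiplet_eq_iff (M M' : {M : ZMod N → ℕ // IsIndexSet N M}) :
    superMultiplet N M.1 = superMultiplet N M'.1 ↔ M ∈ MulAction.orbit (symmGroup N) M' := by
  have key : ∀ A : {M : ZMod N → ℕ // IsIndexSet N M},
      superMultiplet N A.1 = Subtype.val '' MulAction.orbit (symmGroup N) A := by
    intro A
    ext B
    constructor
    · rintro ⟨h, rfl⟩
      refine ⟨_, ⟨(⟨subscriptPerm N h, h, rfl⟩ : symmGroup N)⁻¹, rfl⟩, ?_⟩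
      change (_ • A).1 = _
      rw [symmGroupAction_coe, inv_inv]
      rfl
    · rintro ⟨_, ⟨σ, rfl⟩, rfl⟩
      obtain ⟨h, hh⟩ := (σ⁻¹ : symmGroup N).2
      refine ⟨h, ?_⟩
      change _ = (σ • A).1
      rw [symmGroupAction_coe, ← hh]
      rfl
  rw [key, key, Subtype.val_injective.image_injective.eq_iff, MulAction.orbit_eq_iff]

theorem numSuperMultiplets_eq_card_orbits :
    numSuperMultiplets N = Nat.card
      (MulAction.orbitRel.Quotient (symmGroup N) {M : ZMod N → ℕ // IsIndexSet N M}) := by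
  let f : MulAction.orbitRel.Quotient (symmGroup N) {M : ZMod N → ℕ // IsIndexSet N M} →
      Set (ZMod N → ℕ) := Quotient.lift (fun M => superMultiplet N M.1)
        fun M M' h => (superMultiplet_eq_iff N M M').2 h
  have hf : Function.Injective f := by
    intro x y
    induction x using Quotient.inductionOn
    induction y using Quotient.inductionOn
    intro h
    exact Quotient.sound ((superMultiplet_eq_iff N _ _).1 h)
  rw [← Set.ncard_range_of_injective hf]
  unfold numSuperMultiplets
  congr 1
  ext O
  constructor
  · rintro ⟨M, hM, rfl⟩
    exact ⟨Quotient.mk _ ⟨M, hM⟩, rfl⟩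
  · rintro ⟨q, rfl⟩
    induction q using Quotient.inductionOn with
    | _ M => exact ⟨M.1, M.2, rfl⟩

theorem invariant_zpowers_iff (σ : Equiv.Perm (ZMod N)) (M : ZMod N → ℕ) :
    (∀ τ ∈ Subgroup.zpowers σ, M ∘ τ = M) ↔ M ∘ σ = M := by
  refine ⟨fun h => h σ (Subgroup.mem_zpowers σ), fun h τ hτ => ?_⟩
  obtain ⟨n, -, rfl⟩ := Finset.mem_image.1 (mem_zpowers_iff_mem_range_orderOf.1 hτ)
  clear hτ
  change M ∘ ⇑(σ ^ n) = M
  induction n with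
  | zero => rfl
  | succ n ih =>
    rw [pow_succ, Equiv.Perm.coe_mul, ← Function.comp_assoc, ih, h]

theorem numInvariantSubgroup_zpowers (h : DirectProd N) :
    numInvariantSubgroup N (Subgroup.zpowers (subscriptPerm N h)) = numInvariant N {h} := by
  unfold numInvariantSubgroup numInvariant
  simp_rw [invariant_zpowers_iff, Set.mem_singleton_iff, forall_eq]
  rfl

theorem card_fixedBy (σ : symmGroup N) :
    Nat.card (MulAction.fixedBy {M : ZMod N → ℕ // IsIndexSet N M} σ) =
      numInvariantSubgroup N (Subgroup.zpowers σ.1) := by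
  unfold numInvariantSubgroup
  simp_rw [invariant_zpowers_iff]
  rw [← Nat.card_coe_set_eq]
  refine Nat.card_congr
    ⟨fun M => ⟨M.1.1, M.1.2, ?_⟩, fun M => ⟨⟨M.1, M.2.1⟩, ?_⟩, fun _ => rfl, fun _ => rfl⟩
  · have h := congrArg Subtype.val M.2
    rw [symmGroupAction_coe] at h
    conv_lhs => rw [← h]
    ext k
    simp
  · refine Subtype.ext ?_
    rw [symmGroupAction_coe]
    conv_lhs => rw [← M.2.2]
    ext k
    simp

/-- The parametrisation of the symmetry group by pairs `(a, b)`. It is a bijection, but not a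
homomorphism from the direct product. -/
noncomputable def directProdEquiv : DirectProd N ≃ symmGroup N :=
  Equiv.ofInjective (subscriptPerm N) (subscriptPerm_injective N)

theorem card_symmGroup : Nat.card (symmGroup N) = N * Nat.totient N := by
  rw [← Nat.card_congr (directProdEquiv N), Nat.card_prod, Nat.card_eq_fintype_card,
    Nat.card_eq_fintype_card, Fintype.card_multiplicative, ZMod.card, ZMod.card_units_eq_totient]

/-- Burnside's lemma for the symmetry group, with its elements written as pairs `(a, b)`. -/
theorem sum_numInvariant_singleton :
    ∑ h : DirectProd N, numInvariant N {h} = numSuperMultiplets N * (N * Nat.totient N) := by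
  classical
  have : Finite {M : ZMod N → ℕ // IsIndexSet N M} := finite_setOf_isIndexSet N
  have : Fintype {M : ZMod N → ℕ // IsIndexSet N M} := Fintype.ofFinite _
  have : Fintype (symmGroup N) := Fintype.ofFinite _
  have : Fintype (MulAction.orbitRel.Quotient (symmGroup N) {M : ZMod N → ℕ // IsIndexSet N M}) :=
    Fintype.ofFinite _
  have h := MulAction.sum_card_fixedBy_eq_card_orbits_mul_card_group
    (symmGroup N) {M : ZMod N → ℕ // IsIndexSet N M}
  rw [numSuperMultiplets_eq_card_orbits, ← card_symmGroup, Nat.card_eq_fintype_card,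
    Nat.card_eq_fintype_card, ← h, ← Equiv.sum_comp (directProdEquiv N)]
  refine Finset.sum_congr rfl fun g _ => ?_
  rw [← Nat.card_eq_fintype_card, card_fixedBy, ← numInvariantSubgroup_zpowers]
  rfl

theorem numSuperMultiplets_eq_div :
    (numSuperMultiplets N : ℚ) = 1 / ((N : ℚ) * (Nat.totient N : ℚ)) *
      ∑ h : DirectProd N, (numInvariant N {h} : ℚ) := by
  have h := sum_numInvariant_singleton N
  have hN : (N : ℚ) ≠ 0 := by exact_mod_cast NeZero.ne N
  have hφ : (Nat.totient N : ℚ) ≠ 0 := by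
    exact_mod_cast (Nat.totient_pos.2 (NeZero.pos N)).ne'
  have h' : ∑ h : DirectProd N, (numInvariant N {h} : ℚ) =
      numSuperMultiplets N * (N * Nat.totient N) := by exact_mod_cast h
  rw [h']
  field_simp

theorem sum_numInvariant_eq_finsum_symmGroup :
    ∑ h : DirectProd N, (numInvariant N {h} : ℚ) =
      ∑ᶠ (S : Subgroup (Equiv.Perm (ZMod N))) (_ : S ≤ symmGroup N ∧ IsCyclic S),
        (Nat.totient (Nat.card S) : ℚ) * (numInvariantSubgroup N S : ℚ) := by
  classical
  -- extension by zero to all subgroups of permutations: `zpowers σ ≤ symmGroup N` just means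
  -- `σ ∈ symmGroup N`
  have h := sum_comp_zpowers (Γ := Equiv.Perm (ZMod N))
    (fun S => if S ≤ symmGroup N then (numInvariantSubgroup N S : ℚ) else 0)
  have hR : ∀ S : Subgroup (Equiv.Perm (ZMod N)),
      (∑ᶠ (_ : S ≤ symmGroup N ∧ IsCyclic S),
        (Nat.totient (Nat.card S) : ℚ) * (numInvariantSubgroup N S : ℚ)) =
      ∑ᶠ (_ : IsCyclic S), (Nat.totient (Nat.card S) : ℚ) *
        (if S ≤ symmGroup N then (numInvariantSubgroup N S : ℚ) else 0) := by
    intro S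
    rw [finsum_eq_if, finsum_eq_if]
    by_cases h1 : S ≤ symmGroup N <;> by_cases h2 : IsCyclic S <;> simp [h1, h2]
  rw [finsum_congr hR, ← h]
  simp only [Subgroup.zpowers_le]
  rw [← Finset.sum_filter]
  refine Finset.sum_bij (fun h _ => subscriptPerm N h) ?_ ?_ ?_ ?_
  · intro h _
    exact Finset.mem_filter.2 ⟨Finset.mem_univ _, h, rfl⟩
  · intro a _ b _ hab
    exact subscriptPerm_injective N hab
  · intro σ hσ
    obtain ⟨h, hh⟩ := (Finset.mem_filter.1 hσ).2
    exact ⟨h, Finset.mem_univ _, hh⟩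
  · intro h _
    rw [numInvariantSubgroup_zpowers]

/-- The sum over subgroups of the direct product, given that the number of invariants depends only
on the subgroup generated by a pair, and vanishes for generators of non-cyclic subgroups. -/
theorem sum_numInvariant_eq_finsum_directProd
    (hgen : ∀ g g' : DirectProd N, Subgroup.zpowers g = Subgroup.zpowers g' →
      numInvariant N {g} = numInvariant N {g'})
    (hnc : ∀ T : Set (DirectProd N), ¬ IsCyclic (Subgroup.closure T) → numInvariant N T = 0)
    (T : Subgroup (DirectProd N) → Set (DirectProd N))
    (hT : ∀ S, Subgroup.closure (T S) = S)
    (hcyc : ∀ S : Subgroup (DirectProd N), IsCyclic S → ∃ g, T S = {g}) :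
    ∑ h : DirectProd N, (numInvariant N {h} : ℚ) =
      ∑ᶠ S : Subgroup (DirectProd N),
        (Nat.totient (Nat.card S) : ℚ) * (numInvariant N (T S) : ℚ) := by
  have hL : ∀ h : DirectProd N, numInvariant N {h} = numInvariant N (T (Subgroup.zpowers h)) := by
    intro h
    obtain ⟨g, hg⟩ := hcyc (Subgroup.zpowers h) inferInstance
    rw [hg]
    refine hgen _ _ ?_
    rw [Subgroup.zpowers_eq_closure g, ← hg, hT]
  simp_rw [hL]
  rw [sum_comp_zpowers (fun S => (numInvariant N (T S) : ℚ))]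
  refine finsum_congr fun S => ?_
  classical
  rw [finsum_eq_if]
  split_ifs with h
  · rfl
  · rw [hnc (T S) (by rwa [hT])]
    simp

end Burnside

/-! ### Power series with multichoose coefficients -/

/-- The expansion of `1 / (1 - X ^ d) ^ r` for `d > 0`, whose coefficient of `X ^ (d * k)` is the
number of multisets of size `k` from `r` elements. -/
noncomputable def invOneSubPowSeries (R : Type*) [CommRing R] (d r : ℕ) : PowerSeries R :=
  PowerSeries.mk fun n => if d ∣ n then (Nat.multichoose r (n / d) : R) else 0

section Series

open PowerSeries

variable {R : Type*} [CommRing R]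

theorem coeff_invOneSubPowSeries (d r n : ℕ) :
    coeff n (invOneSubPowSeries R d r) = if d ∣ n then (Nat.multichoose r (n / d) : R) else 0 :=
  coeff_mk _ _

theorem invOneSubPowSeries_zero (d : ℕ) (hd : 0 < d) : invOneSubPowSeries R d 0 = 1 := by
  ext n
  rw [coeff_invOneSubPowSeries, coeff_one]
  split_ifs with h1 h2 h2
  · subst h2; simp
  · obtain ⟨k, rfl⟩ := h1
    rw [Nat.mul_div_cancel_left _ hd]
    cases k with
    | zero => simp at h2
    | succ k => simp
  · subst h2; simp at h1
  · rfl

theorem invOneSubPowSeries_succ_mul (d r : ℕ) (hd : 0 < d) :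
    invOneSubPowSeries R d (r + 1) * (1 - X ^ d) = invOneSubPowSeries R d r := by
  ext n
  rw [mul_sub, mul_one, map_sub, coeff_mul_X_pow']
  simp only [coeff_invOneSubPowSeries]
  by_cases h1 : d ∣ n
  · obtain ⟨k, rfl⟩ := h1
    cases k with
    | zero => simp [hd.ne']
    | succ k =>
      have h2 : d * (k + 1) - d = d * k := by rw [mul_add, mul_one, Nat.add_sub_cancel]
      have h3 : d ≤ d * (k + 1) := Nat.le_mul_of_pos_right _ k.succ_pos
      rw [if_pos h3, h2, if_pos (dvd_mul_right _ _), if_pos (dvd_mul_right _ _),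
        if_pos (dvd_mul_right _ _), Nat.mul_div_cancel_left _ hd, Nat.mul_div_cancel_left _ hd,
        Nat.multichoose_succ_succ]
      push_cast
      ring
  · rw [if_neg h1, if_neg h1]
    by_cases h3 : d ≤ n
    · rw [if_pos h3, if_neg (by rwa [Nat.dvd_sub_iff_left h3 dvd_rfl]), sub_zero]
    · rw [if_neg h3, sub_zero]

theorem invOneSubPowSeries_mul_pow (d r : ℕ) (hd : 0 < d) :
    invOneSubPowSeries R d r * (1 - X ^ d) ^ r = 1 := by
  induction r with
  | zero => rw [invOneSubPowSeries_zero d hd, pow_zero, mul_one]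
  | succ r ih => rw [pow_succ', ← mul_assoc, invOneSubPowSeries_succ_mul d r hd, ih]

theorem invOneSubPowSeries_mul (d r s : ℕ) (hd : 0 < d) :
    invOneSubPowSeries R d r * invOneSubPowSeries R d s = invOneSubPowSeries R d (r + s) := by
  refine left_inv_eq_right_inv (a := (1 - X ^ d) ^ (r + s)) ?_
    (by rw [mul_comm, invOneSubPowSeries_mul_pow d _ hd])
  calc _ = (invOneSubPowSeries R d r * (1 - X ^ d) ^ r) *
        (invOneSubPowSeries R d s * (1 - X ^ d) ^ s) := by rw [pow_add]; ring
    _ = 1 := by rw [invOneSubPowSeries_mul_pow d _ hd, invOneSubPowSeries_mul_pow d _ hd, mul_one]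

theorem rescale_neg_one_invOneSubPowSeries_of_even (d r : ℕ) (hd : Even d) :
    rescale (-1) (invOneSubPowSeries R d r) = invOneSubPowSeries R d r := by
  ext n
  rw [coeff_rescale, coeff_invOneSubPowSeries]
  split_ifs with h
  · rw [Even.neg_one_pow (hd.trans_dvd h), one_mul]
  · rw [mul_zero]

/-- `1 / ((1 + X ^ d) (1 - X ^ d)) = 1 / (1 - X ^ (2 * d))` for odd `d`, to the power `r`. -/
theorem rescale_neg_one_mul_invOneSubPowSeries_of_odd (d r : ℕ) (hd : Odd d) :
    rescale (-1) (invOneSubPowSeries R d r) * invOneSubPowSeries R d r =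
      invOneSubPowSeries R (2 * d) r := by
  have hd0 := hd.pos
  refine left_inv_eq_right_inv (a := (1 - X ^ (2 * d)) ^ r) ?_
    (by rw [mul_comm, invOneSubPowSeries_mul_pow _ _ (by positivity)])
  have h1 := invOneSubPowSeries_mul_pow (R := R) d r hd0
  have h2 := congrArg (rescale (-1)) h1
  rw [map_mul, map_pow, map_sub, map_one, map_pow, rescale_neg_one_X, hd.neg_pow] at h2
  have h3 : (1 - X ^ (2 * d) : PowerSeries R) = (1 - -X ^ d) * (1 - X ^ d) := by
    rw [mul_comm, pow_mul']; ring
  calc _ = (rescale (-1) (invOneSubPowSeries R d r) * (1 - -X ^ d) ^ r) *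
        (invOneSubPowSeries R d r * (1 - X ^ d) ^ r) := by rw [h3, mul_pow]; ring
    _ = 1 := by rw [h1, h2, mul_one]

theorem coeff_mul_invOneSubPowSeries (f : PowerSeries R) (d r n : ℕ) (hd : 0 < d) :
    coeff n (f * invOneSubPowSeries R d r) =
      ∑ T ∈ Finset.range (n / d + 1), (Nat.multichoose r T : R) * coeff (n - d * T) f := by
  rw [coeff_mul, ← Finset.Nat.sum_antidiagonal_swap,
    Finset.Nat.sum_antidiagonal_eq_sum_range_succ_mk]
  simp only [Prod.swap, coeff_invOneSubPowSeries, mul_ite, mul_zero]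
  rw [← Finset.sum_filter]
  symm
  refine Finset.sum_bij (fun T _ => d * T) ?_ ?_ ?_ ?_
  · intro T hT
    rw [Finset.mem_range_succ_iff, Nat.le_div_iff_mul_le hd] at hT
    simp only [Finset.mem_filter, Finset.mem_range_succ_iff, dvd_mul_right, and_true]
    rwa [mul_comm]
  · intro a _ b _ hab
    exact Nat.eq_of_mul_eq_mul_left hd hab
  · intro k hk
    simp only [Finset.mem_filter, Finset.mem_range_succ_iff] at hk
    obtain ⟨hk, T, rfl⟩ := hk
    refine ⟨T, ?_, rfl⟩
    rw [Finset.mem_range_succ_iff, Nat.le_div_iff_mul_le hd]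
    rwa [mul_comm]
  · intro T _
    rw [Nat.mul_div_cancel_left _ hd, mul_comm]

/-- The part of a convolution square with even first index, as a signed average. -/
theorem two_mul_sum_antidiagonal_even (f : PowerSeries R) (n : ℕ) :
    2 * ∑ ij ∈ Finset.HasAntidiagonal.antidiagonal n with Even ij.1, coeff ij.1 f * coeff ij.2 f =
      coeff n (f * f) + coeff n (rescale (-1) f * f) := by
  rw [coeff_mul, coeff_mul, ← Finset.sum_add_distrib, Finset.sum_filter, Finset.mul_sum]
  refine Finset.sum_congr rfl fun ij _ => ?_
  rw [coeff_rescale]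
  split_ifs with h
  · rw [h.neg_one_pow]; ring
  · rw [(Nat.not_even_iff_odd.1 h).neg_one_pow]; ring

/-- The complete homogeneous sums of a family are the coefficients of `∏ 1 / (1 - x i X)`. -/
theorem mk_sum_piAntidiag_mul_prod {ι : Type*} [Fintype ι] [DecidableEq ι] (x : ι → R) :
    (PowerSeries.mk fun n => ∑ f ∈ Finset.piAntidiag (Finset.univ : Finset ι) n, ∏ i, x i ^ f i) *
      ∏ i, (1 - C (x i) * X) = 1 := by
  have h1 : (PowerSeries.mk fun n =>
      ∑ f ∈ Finset.piAntidiag (Finset.univ : Finset ι) n, ∏ i, x i ^ f i) =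
      ∏ i, PowerSeries.mk fun n => x i ^ n := by
    ext n
    rw [coeff_mk, coeff_prod]
    simp only [coeff_mk]
    symm
    refine Finset.sum_bij (fun l _ => ⇑l) ?_ ?_ ?_ ?_
    · intro l hl
      simpa using hl
    · intro a _ b _ h
      exact DFunLike.coe_injective h
    · intro f hf
      exact ⟨Finsupp.equivFunOnFinite.symm f, by simpa using hf, rfl⟩
    · intro l _
      rfl
  rw [h1, ← Finset.prod_mul_distrib]
  refine Finset.prod_eq_one fun i _ => ?_
  ext n
  rw [mul_sub, mul_one, map_sub, coeff_one, ← mul_assoc, mul_comm _ (C (x i)), mul_assoc,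
    coeff_C_mul]
  cases n with
  | zero => simp
  | succ n => rw [coeff_succ_mul_X, coeff_mk, coeff_mk]; simp [pow_succ']

end Series

theorem card_piAntidiag_univ (ι : Type*) [Fintype ι] [DecidableEq ι] (n : ℕ) :
    (Finset.piAntidiag (Finset.univ : Finset ι) n).card =
      Nat.multichoose (Fintype.card ι) n := by
  rw [← Finset.card_univ, ← Finset.card_finsuppAntidiag_nat_eq_multichoose]
  symm
  refine Finset.card_bij (fun l _ => ⇑l) ?_ ?_ ?_
  · intro l hl
    simpa using hl
  · intro a _ b _ h
    exact DFunLike.coe_injective h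
  · intro f hf
    exact ⟨Finsupp.equivFunOnFinite.symm f, by simpa using hf, rfl⟩

theorem sum_multichoose_mul_sub (r n : ℕ) :
    ∑ T ∈ Finset.range (n + 1), Nat.multichoose r T * (n - T) = (n + r).choose (r + 1) := by
  induction n with
  | zero => simp
  | succ n ih =>
    have h : ∀ T ∈ Finset.range (n + 1), Nat.multichoose r T * (n + 1 - T) =
        Nat.multichoose r T * (n - T) + Nat.multichoose r T := by
      intro T hT
      rw [Finset.mem_range] at hT
      rw [show n + 1 - T = (n - T) + 1 by omega, mul_add, mul_one]
    rw [Finset.sum_range_succ, Finset.sum_congr rfl h, Finset.sum_add_distrib, ih, Nat.sub_self,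
      mul_zero, add_zero, Nat.sum_range_multichoose, show n + 1 + r = (n + r) + 1 by ring,
      Nat.choose_succ_succ, add_comm]

/-! ### Multiplicity functions fixed by an affine permutation modulo a prime -/

/-- The functions `M` of total mass `n` with `M ∘ σ = M`. -/
def fixFinset (p : ℕ) [NeZero p] (σ : Equiv.Perm (ZMod p)) (n : ℕ) : Finset (ZMod p → ℕ) :=
  (Finset.piAntidiag Finset.univ n).filter fun M => M ∘ σ = M

/-- The moment `∑ k * M k` modulo `p`. -/
def moment (p : ℕ) [NeZero p] (M : ZMod p → ℕ) : ZMod p := ∑ k, k * (M k : ZMod p)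

section Fix

variable (p : ℕ) [NeZero p]

theorem mem_fixFinset {σ : Equiv.Perm (ZMod p)} {n : ℕ} {M : ZMod p → ℕ} :
    M ∈ fixFinset p σ n ↔ ∑ k, M k = n ∧ M ∘ σ = M := by
  simp [fixFinset]

theorem moment_comp_subscriptPerm (h : DirectProd p) (M : ZMod p → ℕ) :
    moment p (M ∘ subscriptPerm p h) =
      (h.2 : ZMod p) * moment p M +
        Multiplicative.toAdd h.1 * (h.2 : ZMod p) * ((∑ k, M k : ℕ) : ZMod p) := by
  have e : ∀ k, (subscriptPerm p h).symm k = (k + Multiplicative.toAdd h.1) * (h.2 : ZMod p) :=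
    fun _ => rfl
  unfold moment
  rw [← Equiv.sum_comp (subscriptPerm p h).symm]
  simp only [Function.comp_apply, Equiv.apply_symm_apply]
  simp only [e]
  rw [Finset.mul_sum, Nat.cast_sum, Finset.mul_sum, ← Finset.sum_add_distrib]
  exact Finset.sum_congr rfl fun k _ => by ring

variable {p}

/-- A nonzero translation acts transitively, since `p` is prime. -/
theorem constant_of_translation_invariant (hp : p.Prime) (h : DirectProd p) (h1 : h.1 ≠ 1)
    (h2 : h.2 = 1) (M : ZMod p → ℕ) (hM : M ∘ subscriptPerm p h = M) (k : ZMod p) : M k = M 0 := by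
  have : Fact p.Prime := ⟨hp⟩
  set a : ZMod p := Multiplicative.toAdd h.1 with ha
  have ha0 : a ≠ 0 := fun h0 => h1 (Multiplicative.toAdd.injective h0)
  have hstep : ∀ k, M (k - a) = M k := fun k => by
    conv_rhs => rw [← hM]
    simp [subscriptPerm, h2, ha]
  have hj : ∀ j : ℕ, M (j * a) = M 0 := by
    intro j
    induction j with
    | zero => simp
    | succ j ih => rw [← ih, ← hstep]; congr 1; push_cast; ring
  rw [← hj (k * a⁻¹).val, ZMod.natCast_zmod_val, mul_assoc, inv_mul_cancel₀ ha0, mul_one]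

theorem card_fixFinset_translation (hp : p.Prime) (h : DirectProd p) (h1 : h.1 ≠ 1)
    (h2 : h.2 = 1) (n : ℕ) :
    (fixFinset p (subscriptPerm p h) n).card = if p ∣ n then 1 else 0 := by
  split_ifs with hn
  · obtain ⟨c, rfl⟩ := hn
    rw [Finset.card_eq_one]
    refine ⟨fun _ => c, ?_⟩
    ext M
    rw [mem_fixFinset, Finset.mem_singleton]
    constructor
    · rintro ⟨hs, hM⟩
      have hc := constant_of_translation_invariant hp h h1 h2 M hM
      rw [Finset.sum_congr rfl (fun k _ => hc k)] at hs
      have h0 : M 0 = c := by simpa [hp.ne_zero] using hs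
      exact funext fun k => (hc k).trans h0
    · rintro rfl
      refine ⟨?_, rfl⟩
      simp
  · rw [Finset.card_eq_zero, Finset.eq_empty_iff_forall_notMem]
    intro M hM
    rw [mem_fixFinset] at hM
    have hc := constant_of_translation_invariant hp h h1 h2 M hM.2
    refine hn ⟨M 0, ?_⟩
    rw [← hM.1, Finset.sum_congr rfl (fun k _ => hc k)]
    simp

theorem moment_const (hp : p.Prime) (hodd : Odd p) (c : ℕ) : moment p (fun _ => c) = 0 := by
  have : Fact p.Prime := ⟨hp⟩
  have h0 : ∑ k : ZMod p, k = 0 := by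
    -- the sum equals its own negative, and `2` is invertible
    have h1 : ∑ k : ZMod p, k = ∑ k : ZMod p, -k :=
      (Equiv.sum_comp (Equiv.neg (ZMod p)) fun k => k).symm
    rw [Finset.sum_neg_distrib] at h1
    have h2 : (2 : ZMod p) ≠ 0 := by
      intro h
      have h3 : ((2 : ℕ) : ZMod p) = 0 := by exact_mod_cast h
      rw [ZMod.natCast_eq_zero_iff, Nat.prime_dvd_prime_iff_eq hp Nat.prime_two] at h3
      subst h3
      exact absurd hodd (by decide)
    have h3 : (2 : ZMod p) * ∑ k : ZMod p, k = 0 := by linear_combination h1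
    exact (mul_eq_zero.1 h3).resolve_left h2
  unfold moment
  rw [← Finset.sum_mul, h0, zero_mul]

theorem sum_eq_add_sum_units (hp : p.Prime) (c : ZMod p) (g : ZMod p → ℕ) :
    ∑ k, g k = g c + ∑ u : (ZMod p)ˣ, g (c + u) := by
  have : Fact p.Prime := ⟨hp⟩
  rw [← Equiv.sum_comp (Equiv.addLeft c) g, Fintype.sum_eq_add_sum_subtype_ne _ 0,
    ← Equiv.sum_comp unitsEquivNeZero]
  simp [unitsEquivNeZero]

theorem sum_comp_quotient_mk {G : Type*} [CommGroup G] [Fintype G] (S : Subgroup G)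
    [Fintype (G ⧸ S)] (f : G ⧸ S → ℕ) :
    ∑ g : G, f (QuotientGroup.mk g) = Nat.card S * ∑ q, f q := by
  classical
  rw [← Finset.sum_fiberwise _ (fun g : G => (QuotientGroup.mk g : G ⧸ S)), Finset.mul_sum]
  refine Finset.sum_congr rfl fun q _ => ?_
  rw [Finset.sum_congr rfl (g := fun _ => f q) (fun g hg => by rw [(Finset.mem_filter.1 hg).2]),
    Finset.sum_const, smul_eq_mul]
  congr 1
  induction q using QuotientGroup.induction_on with
  | _ z =>
    rw [← Fintype.card_subtype, ← Nat.card_eq_fintype_card]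
    refine Nat.card_congr ⟨fun g => ⟨z⁻¹ * g.1, QuotientGroup.eq.1 g.2.symm⟩,
      fun s => ⟨z * s.1, ?_⟩, fun g => ?_, fun s => ?_⟩
    · rw [QuotientGroup.mk_mul_of_mem _ s.2]
    · simp
    · simp

/-- The functions fixed by an affine map with multiplier `b⁻¹ ≠ 1` are given by a value at the
fixed point and one value on each coset of `⟨b⟩` around it. -/
theorem card_fixFinset_of_ne_one (hp : p.Prime) (h : DirectProd p) (h2 : h.2 ≠ 1) (n : ℕ) :
    (fixFinset p (subscriptPerm p h) n).card =
      ∑ T ∈ Finset.range (n / orderOf h.2 + 1), Nat.multichoose ((p - 1) / orderOf h.2) T := by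
  classical
  have : Fact p.Prime := ⟨hp⟩
  obtain ⟨a, b⟩ := h
  dsimp only at h2 ⊢
  set d := orderOf b with hd
  have hd0 : 0 < d := orderOf_pos b
  let Q := (ZMod p)ˣ ⧸ Subgroup.zpowers b
  let _ : Fintype Q := Fintype.ofFinite Q
  have hQ : Fintype.card Q = (p - 1) / d := by
    have h := Subgroup.card_eq_card_quotient_mul_card_subgroup (Subgroup.zpowers b)
    rw [Nat.card_zpowers, Nat.card_eq_fintype_card, Nat.card_eq_fintype_card,
      ZMod.card_units_eq_totient, Nat.totient_prime hp] at h
    rw [h, Nat.mul_div_cancel _ hd0]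
  -- the fixed point of `k ↦ k * b⁻¹ - a`
  obtain ⟨c, hc⟩ : ∃ c : ZMod p, ∀ u : ZMod p,
      subscriptPerm p (a, b) (c + u) = c + u * ((b⁻¹ : (ZMod p)ˣ) : ZMod p) := by
    have hb : ((b⁻¹ : (ZMod p)ˣ) : ZMod p) - 1 ≠ 0 := by
      rw [sub_ne_zero]
      intro hb
      exact h2 (inv_eq_one.1 (Units.ext hb))
    refine ⟨Multiplicative.toAdd a / (((b⁻¹ : (ZMod p)ˣ) : ZMod p) - 1), fun u => ?_⟩
    change (_ + u) * _ - Multiplicative.toAdd a = _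
    field_simp
    ring
  have hsum : ∀ f : Q → ℕ, ∑ u : (ZMod p)ˣ, f (QuotientGroup.mk u) = d * ∑ q, f q := by
    intro f
    rw [sum_comp_quotient_mk, Nat.card_zpowers]
  have hk : ∀ k : ZMod p, k ≠ c → ∃ u : (ZMod p)ˣ, k = c + u := fun k hk =>
    ⟨Units.mk0 (k - c) (sub_ne_zero.2 hk), by simp⟩
  have hcc : subscriptPerm p (a, b) c = c := by
    have h0 := hc 0
    rwa [add_zero, zero_mul, add_zero] at h0
  have hcu' : ∀ u : (ZMod p)ˣ,
      subscriptPerm p (a, b) (c + u) = c + ((u * b⁻¹ : (ZMod p)ˣ) : ZMod p) :=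
    fun u => by rw [hc, Units.val_mul]
  -- the fixed function with values `f` on the cosets; total mass `n` determines its value at `c`
  let F : (Q → ℕ) → ZMod p → ℕ := fun f k =>
    if hk : k - c = 0 then n - d * ∑ q, f q else f (QuotientGroup.mk (Units.mk0 (k - c) hk))
  have hFc : ∀ f, F f c = n - d * ∑ q, f q := fun f => by simp [F]
  have hFu : ∀ f (u : (ZMod p)ˣ), F f (c + u) = f (QuotientGroup.mk u) := fun f u => by
    have hne : ¬ (c + (u : ZMod p) - c = 0) := by
      rw [add_sub_cancel_left]
      exact u.ne_zero
    simp only [F, dif_neg hne]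
    congr 2
    ext
    simp
  have hcard : ∀ T, Nat.multichoose ((p - 1) / d) T =
      (Finset.piAntidiag (Finset.univ : Finset Q) T).card := fun T => by
    rw [card_piAntidiag_univ, hQ]
  simp_rw [hcard]
  rw [← Finset.card_sigma]
  symm
  refine Finset.card_bij (fun x _ => F x.2) ?_ ?_ ?_
  · rintro ⟨T, f⟩ hx
    simp only [Finset.mem_sigma, Finset.mem_range_succ_iff, Finset.mem_piAntidiag,
      Nat.le_div_iff_mul_le hd0] at hx
    obtain ⟨hT, hf, -⟩ := hx
    rw [mem_fixFinset]
    constructor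
    · rw [sum_eq_add_sum_units hp c]
      simp only [hFc, hFu, hsum]
      rw [Nat.sub_add_cancel]
      change d * Finset.univ.sum f ≤ n
      rw [hf, mul_comm]
      exact hT
    · funext k
      by_cases hkc : k = c
      · rw [Function.comp_apply, hkc, hcc]
      · obtain ⟨u, rfl⟩ := hk k hkc
        rw [Function.comp_apply, hcu', hFu, hFu, QuotientGroup.mk_mul_of_mem]
        simp
  · rintro ⟨T, f⟩ hx ⟨T', f'⟩ hx' hff
    simp only [Finset.mem_sigma, Finset.mem_piAntidiag] at hx hx'
    have h1 : f = f' := by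
      funext q
      induction q using QuotientGroup.induction_on with
      | _ z => rw [← hFu f, ← hFu f']; exact congrFun hff _
    subst h1
    obtain rfl : T = T' := hx.2.1.symm.trans hx'.2.1
    rfl
  · intro M hM
    rw [mem_fixFinset] at hM
    obtain ⟨hs, hM⟩ := hM
    have hMu : ∀ u : (ZMod p)ˣ, M (c + ((u * b⁻¹ : (ZMod p)ˣ) : ZMod p)) = M (c + u) := fun u => by
      rw [← hcu']; exact congrFun hM _
    have hMz : ∀ (u : (ZMod p)ˣ) (j : ℕ),
        M (c + ((u * b ^ j : (ZMod p)ˣ) : ZMod p)) = M (c + u) := by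
      intro u j
      induction j with
      | zero => simp
      | succ j ih => rw [← ih, ← hMu (u * b ^ (j + 1)), pow_succ, mul_assoc u, mul_inv_cancel_right]
    let f : Q → ℕ := Quotient.lift (fun u : (ZMod p)ˣ => M (c + u)) (by
      intro u v huv
      have huv' : u⁻¹ * v ∈ Subgroup.zpowers b := QuotientGroup.leftRel_apply.1 huv
      obtain ⟨j, -, hj⟩ := Finset.mem_image.1 (mem_zpowers_iff_mem_range_orderOf.1 huv')
      have hv : v = u * b ^ j := by rw [hj]; simp
      rw [hv]
      exact (hMz u j).symm)
    have hfu : ∀ u : (ZMod p)ˣ, f (QuotientGroup.mk u) = M (c + u) := fun u => rfl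
    have hs' : M c + d * ∑ q, f q = n := by
      rw [← hs, sum_eq_add_sum_units hp c, ← hsum]
      rfl
    refine ⟨⟨∑ q, f q, f⟩, ?_, ?_⟩
    · simp only [Finset.mem_sigma, Finset.mem_range_succ_iff, Finset.mem_piAntidiag,
        Nat.le_div_iff_mul_le hd0]
      refine ⟨?_, by simp⟩
      rw [mul_comm]
      omega
    · funext k
      by_cases hkc : k = c
      · rw [hkc]
        change F f c = M c
        rw [hFc]
        omega
      · obtain ⟨u, rfl⟩ := hk k hkc
        change F f _ = _
        rw [hFu]
        rfl

end Fix

/-! ### Counting functions with vanishing moment -/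

section CharacterSums

open PowerSeries

theorem coeff_sq_add_invOneSubPowSeries_prime {R : Type*} [CommRing R] {p : ℕ} (hp : p.Prime)
    (hodd : Odd p) :
    coeff (2 * p) (invOneSubPowSeries R p 1 * invOneSubPowSeries R p 1) +
      coeff (2 * p) (rescale (-1) (invOneSubPowSeries R p 1) * invOneSubPowSeries R p 1) = 4 := by
  rw [invOneSubPowSeries_mul _ _ _ hp.pos, rescale_neg_one_mul_invOneSubPowSeries_of_odd _ _ hodd,
    coeff_invOneSubPowSeries, coeff_invOneSubPowSeries, if_pos (dvd_mul_left _ _), if_pos dvd_rfl,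
    Nat.mul_div_cancel _ hp.pos, Nat.div_self (by have := hp.pos; omega)]
  norm_num [Nat.multichoose]

theorem div_eq_of_eq_mul_add_one {P d m : ℕ} (hd : 2 ≤ d) (h : P = d * m + 1) : P / d = m := by
  rw [h, Nat.mul_add_div (by omega), Nat.div_eq_of_lt (by omega), add_zero]

variable {p : ℕ} [NeZero p]

theorem stdAddChar_mul_moment (t : ZMod p) (M : ZMod p → ℕ) :
    ZMod.stdAddChar (t * moment p M) = ∏ k, (ZMod.stdAddChar (t * k) : ℂ) ^ M k := by
  have h : ∀ s : Finset (ZMod p), (ZMod.stdAddChar (t * ∑ k ∈ s, k * (M k : ZMod p)) : ℂ) =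
      ∏ k ∈ s, (ZMod.stdAddChar (t * k) : ℂ) ^ M k := by
    classical
    intro s
    induction s using Finset.induction_on with
    | empty => simp
    | insert k s hk ih =>
      rw [Finset.sum_insert hk, Finset.prod_insert hk, mul_add, AddChar.map_add_eq_mul, ih,
        ← AddChar.map_nsmul_eq_pow, nsmul_eq_mul]
      congr 2
      ring
  exact h Finset.univ

theorem prod_one_sub_stdAddChar (hp : p.Prime) (t : ZMod p) (ht : t ≠ 0) :
    ∏ k : ZMod p, (1 - C (ZMod.stdAddChar (t * k) : ℂ) * X) = 1 - X ^ p := by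
  classical
  have : Fact p.Prime := ⟨hp⟩
  let ψ : ZMod p → PowerSeries ℂ := fun k => C (ZMod.stdAddChar (t * k) : ℂ)
  have hinj : Function.Injective ψ := fun a b hab =>
    mul_left_cancel₀ ht (ZMod.injective_stdAddChar (C_injective hab))
  have hpow : ∀ k, ψ k ^ p = 1 := fun k => by
    simp only [ψ]
    rw [← map_pow, ← AddChar.map_nsmul_eq_pow]
    simp
  have hζ : IsPrimitiveRoot (ψ 1) p := by
    rw [IsPrimitiveRoot.iff_orderOf]
    refine orderOf_eq_prime (hpow 1) fun h1 => ?_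
    have h2 : ψ 1 = ψ 0 := by rw [h1]; simp [ψ]
    exact one_ne_zero (hinj h2)
  have himg : Finset.univ.image ψ = Polynomial.nthRootsFinset p (1 : PowerSeries ℂ) := by
    refine Finset.eq_of_subset_of_card_le ?_ ?_
    · intro x hx
      obtain ⟨k, -, rfl⟩ := Finset.mem_image.1 hx
      exact (Polynomial.mem_nthRootsFinset hp.pos 1).2 (hpow k)
    · rw [hζ.card_nthRootsFinset, Finset.card_image_of_injective _ hinj, Finset.card_univ,
        ZMod.card]
  have h := IsPrimitiveRoot.pow_sub_pow_eq_prod_sub_mul (1 : PowerSeries ℂ) X hp.pos hζ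
  rw [one_pow, ← himg, Finset.prod_image hinj.injOn] at h
  exact h.symm

/-- The sum of a character of the moment over all functions of total mass `n`. -/
noncomputable def momentSum (t : ZMod p) (n : ℕ) : ℂ :=
  ∑ M ∈ fixFinset p 1 n, ZMod.stdAddChar (t * moment p M)

theorem fixFinset_one (n : ℕ) : fixFinset p 1 n = Finset.piAntidiag Finset.univ n := by
  ext M
  simp [fixFinset]

theorem mk_momentSum_zero :
    (PowerSeries.mk (momentSum (0 : ZMod p))) = invOneSubPowSeries ℂ 1 p := by
  ext n
  rw [coeff_mk, coeff_invOneSubPowSeries, momentSum, fixFinset_one]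
  simp [card_piAntidiag_univ, ZMod.card]

/-- For a nontrivial character the roots of unity multiply out to
`∏ (1 - ζ ^ k * X) = 1 - X ^ p`. -/
theorem mk_momentSum_of_ne_zero (hp : p.Prime) (t : ZMod p) (ht : t ≠ 0) :
    (PowerSeries.mk (momentSum t)) = invOneSubPowSeries ℂ p 1 := by
  have h := mk_sum_piAntidiag_mul_prod (R := ℂ) (fun k : ZMod p => ZMod.stdAddChar (t * k))
  rw [prod_one_sub_stdAddChar hp t ht] at h
  have h2 := invOneSubPowSeries_mul_pow (R := ℂ) p 1 hp.pos
  rw [pow_one, mul_comm] at h2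
  rw [← left_inv_eq_right_inv h h2]
  ext n
  rw [coeff_mk, coeff_mk, momentSum, fixFinset_one]
  exact Finset.sum_congr rfl fun M _ => stdAddChar_mul_moment t M

/-- Orthogonality of additive characters. -/
theorem card_filter_eq_zero_mul {α : Type*} (s : Finset α) (w : α → ZMod p) :
    (p : ℂ) * ((s.filter fun x => w x = 0).card : ℂ) =
      ∑ t : ZMod p, ∑ x ∈ s, (ZMod.stdAddChar (t * w x) : ℂ) := by
  rw [Finset.sum_comm, Finset.card_filter]
  push_cast
  rw [Finset.mul_sum]
  refine Finset.sum_congr rfl fun x _ => ?_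
  rw [AddChar.sum_mulShift _ (ZMod.isPrimitive_stdAddChar p), ZMod.card]
  split_ifs <;> simp

theorem sum_zmod_eq_add (c : ZMod p → ℂ) (c0 c1 : ℂ) (h0 : c 0 = c0)
    (h1 : ∀ t, t ≠ 0 → c t = c1) : ∑ t, c t = c0 + ((p : ℂ) - 1) * c1 := by
  rw [Fintype.sum_eq_add_sum_subtype_ne _ 0, h0,
    Finset.sum_congr rfl (g := fun _ => c1) (fun t _ => h1 t.1 t.2), Finset.sum_const,
    Finset.card_univ, nsmul_eq_mul]
  congr 2
  simp [Fintype.card_subtype_compl, ZMod.card, Nat.cast_sub (NeZero.one_le : 1 ≤ p)]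

/-- The number of pairs of functions of masses `i`, `j` fixed by `σ` and with opposite moments. -/
def pairCount (p : ℕ) [NeZero p] (σ : Equiv.Perm (ZMod p)) (i j : ℕ) : ℕ :=
  ((fixFinset p σ i ×ˢ fixFinset p σ j).filter fun M => moment p M.1 + moment p M.2 = 0).card

/-- The number of pairs of functions fixed by `σ`, the first of even mass, with total mass `2 * p`
and total moment zero. -/
def evenPairCount (p : ℕ) [NeZero p] (σ : Equiv.Perm (ZMod p)) : ℕ :=
  ∑ ij ∈ Finset.HasAntidiagonal.antidiagonal (2 * p) with Even ij.1, pairCount p σ ij.1 ij.2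

theorem mul_card_filter_moment_one (hp : p.Prime) :
    (p : ℚ) * (((fixFinset p 1 p).filter fun M => moment p M = 0).card : ℚ) =
      Nat.multichoose p p + (p - 1) := by
  have h : (p : ℂ) * (((fixFinset p 1 p).filter fun M => moment p M = 0).card : ℂ) =
      Nat.multichoose p p + ((p : ℂ) - 1) * 1 := by
    rw [card_filter_eq_zero_mul]
    refine sum_zmod_eq_add _ _ _ ?_ fun t ht => ?_
    · have := congrArg (coeff p) (mk_momentSum_zero (p := p))
      rw [coeff_mk, coeff_invOneSubPowSeries, if_pos (one_dvd _), Nat.div_one] at this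
      exact this
    · have := congrArg (coeff p) (mk_momentSum_of_ne_zero hp t ht)
      rw [coeff_mk, coeff_invOneSubPowSeries, if_pos dvd_rfl, Nat.multichoose_one,
        Nat.cast_one] at this
      exact this
  rw [mul_one] at h
  exact_mod_cast h

theorem mul_evenPairCount_one (hp : p.Prime) (hodd : Odd p) :
    (p : ℚ) * (2 * evenPairCount p 1) =
      Nat.multichoose (2 * p) (2 * p) + Nat.multichoose p p + (p - 1) * 4 := by
  have hterm : ∀ i j, (p : ℂ) * (pairCount p 1 i j : ℂ) =
      ∑ t : ZMod p, momentSum t i * momentSum t j := by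
    intro i j
    rw [pairCount, card_filter_eq_zero_mul]
    refine Finset.sum_congr rfl fun t _ => ?_
    rw [momentSum, momentSum, Finset.sum_mul_sum, ← Finset.sum_product']
    refine Finset.sum_congr rfl fun M _ => ?_
    rw [mul_add, AddChar.map_add_eq_mul]
  have h : (p : ℂ) * (2 * evenPairCount p 1) =
      (Nat.multichoose (2 * p) (2 * p) + Nat.multichoose p p) + ((p : ℂ) - 1) * 4 := by
    have h1 : (p : ℂ) * (2 * evenPairCount p 1) = ∑ t : ZMod p,
        2 * ∑ ij ∈ Finset.HasAntidiagonal.antidiagonal (2 * p) with Even ij.1,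
          coeff ij.1 (PowerSeries.mk (momentSum t)) *
            coeff ij.2 (PowerSeries.mk (momentSum t)) := by
      simp only [coeff_mk]
      rw [← Finset.mul_sum, Finset.sum_comm, evenPairCount, mul_left_comm]
      push_cast
      rw [Finset.mul_sum]
      congr 1
      exact Finset.sum_congr rfl fun ij _ => hterm _ _
    rw [h1]
    refine sum_zmod_eq_add _ _ _ ?_ fun t ht => ?_
    · rw [two_mul_sum_antidiagonal_even, mk_momentSum_zero, invOneSubPowSeries_mul _ _ _ one_pos,
        rescale_neg_one_mul_invOneSubPowSeries_of_odd _ _ odd_one, coeff_invOneSubPowSeries,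
        coeff_invOneSubPowSeries, mul_one, if_pos (one_dvd _), if_pos (dvd_mul_right _ _),
        Nat.div_one, Nat.mul_div_cancel_left _ two_pos, two_mul]
    · rw [two_mul_sum_antidiagonal_even, mk_momentSum_of_ne_zero hp t ht,
        coeff_sq_add_invOneSubPowSeries_prime hp hodd]
  exact_mod_cast h

/-! ### Fixed points of a non-identity affine permutation -/

/-- The moment `s` of a function invariant under `(a, b)` with mass divisible by `p` satisfies
`s = b * s`. -/
theorem moment_eq_zero_of_invariant (hp : p.Prime) (h : DirectProd p) (h2 : h.2 ≠ 1)
    (M : ZMod p → ℕ) (hM : M ∘ subscriptPerm p h = M) (hs : p ∣ ∑ k, M k) : moment p M = 0 := by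
  have : Fact p.Prime := ⟨hp⟩
  have h1 := moment_comp_subscriptPerm p h M
  rw [hM, (ZMod.natCast_eq_zero_iff _ _).2 hs, mul_zero, add_zero] at h1
  have hb : (1 - (h.2 : ZMod p)) ≠ 0 := by
    rw [sub_ne_zero]
    exact fun hb => h2 (Units.ext hb.symm)
  have h3 : (1 - (h.2 : ZMod p)) * moment p M = 0 := by linear_combination h1
  exact (mul_eq_zero.1 h3).resolve_left hb

theorem moment_add (M M' : ZMod p → ℕ) : moment p (M + M') = moment p M + moment p M' := by
  simp [moment, mul_add, Finset.sum_add_distrib]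

theorem pairCount_of_ne_one (hp : p.Prime) (hodd : Odd p) (h : DirectProd p) (hh : h ≠ 1)
    (i j : ℕ) (hij : i + j = 2 * p) :
    pairCount p (subscriptPerm p h) i j =
      (fixFinset p (subscriptPerm p h) i).card * (fixFinset p (subscriptPerm p h) j).card := by
  rw [pairCount, ← Finset.card_product, Finset.filter_true_of_mem]
  rintro ⟨M, M'⟩ hM
  simp only [Finset.mem_product, mem_fixFinset] at hM
  obtain ⟨⟨hs, hM⟩, hs', hM'⟩ := hM
  by_cases h2 : h.2 = 1
  · have h1 : h.1 ≠ 1 := fun h1 => hh (Prod.ext h1 h2)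
    rw [funext (constant_of_translation_invariant hp h h1 h2 M hM),
      funext (constant_of_translation_invariant hp h h1 h2 M' hM'), moment_const hp hodd,
      moment_const hp hodd, add_zero]
  · rw [← moment_add]
    refine moment_eq_zero_of_invariant hp h h2 _ ?_ ?_
    · funext k
      exact congrArg₂ (· + ·) (congrFun hM k) (congrFun hM' k)
    · simp only [Pi.add_apply, Finset.sum_add_distrib, hs, hs', hij]
      exact dvd_mul_left _ _

theorem two_mul_evenPairCount (hp : p.Prime) (hodd : Odd p) (h : DirectProd p) (hh : h ≠ 1)
    (f : PowerSeries ℚ)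
    (hf : ∀ n, coeff n f = ((fixFinset p (subscriptPerm p h) n).card : ℚ)) :
    (2 * evenPairCount p (subscriptPerm p h) : ℚ) =
      coeff (2 * p) (f * f) + coeff (2 * p) (rescale (-1) f * f) := by
  rw [← two_mul_sum_antidiagonal_even, evenPairCount]
  push_cast
  congr 1
  refine Finset.sum_congr rfl fun ij hij => ?_
  rw [pairCount_of_ne_one hp hodd h hh _ _
    (Finset.HasAntidiagonal.mem_antidiagonal.1 (Finset.mem_filter.1 hij).1), hf, hf]
  push_cast
  rfl

theorem evenPairCount_translation (hp : p.Prime) (hodd : Odd p) (h : DirectProd p) (h1 : h.1 ≠ 1)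
    (h2 : h.2 = 1) : evenPairCount p (subscriptPerm p h) = 2 := by
  have h3 := two_mul_evenPairCount hp hodd h (fun hh => h1 (by rw [hh]; rfl))
    (invOneSubPowSeries ℚ p 1) (fun n => by
      rw [coeff_invOneSubPowSeries, card_fixFinset_translation hp h h1 h2]
      simp)
  rw [coeff_sq_add_invOneSubPowSeries_prime hp hodd] at h3
  have h4 : (evenPairCount p (subscriptPerm p h) : ℚ) = 2 := by linarith
  exact_mod_cast h4

theorem card_filter_moment_translation (hp : p.Prime) (hodd : Odd p) (h : DirectProd p)
    (h1 : h.1 ≠ 1) (h2 : h.2 = 1) :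
    ((fixFinset p (subscriptPerm p h) p).filter fun M => moment p M = 0).card = 1 := by
  rw [Finset.filter_true_of_mem, card_fixFinset_translation hp h h1 h2, if_pos dvd_rfl]
  intro M hM
  rw [funext (constant_of_translation_invariant hp h h1 h2 M ((mem_fixFinset p).1 hM).2)]
  exact moment_const hp hodd _

theorem exists_mul_orderOf_eq (hp : p.Prime) (b : (ZMod p)ˣ) (hb : b ≠ 1) :
    2 ≤ orderOf b ∧ 0 < (p - 1) / orderOf b ∧ p = orderOf b * ((p - 1) / orderOf b) + 1 := by
  have : Fact p.Prime := ⟨hp⟩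
  have h1 : orderOf b ∣ p - 1 := by
    have := orderOf_dvd_card (x := b)
    rwa [ZMod.card_units_eq_totient, Nat.totient_prime hp] at this
  have h2 := orderOf_pos b
  have h3 : orderOf b ≠ 1 := fun h => hb (orderOf_eq_one_iff.1 h)
  have h4 := hp.two_le
  have h5 := Nat.mul_div_cancel' h1
  refine ⟨by omega, Nat.div_pos (Nat.le_of_dvd (by omega) h1) h2, by omega⟩

theorem card_filter_moment_of_ne_one (hp : p.Prime) (h : DirectProd p) (h2 : h.2 ≠ 1) :
    ((fixFinset p (subscriptPerm p h) p).filter fun M => moment p M = 0).card =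
      (2 * ((p - 1) / orderOf h.2)).choose ((p - 1) / orderOf h.2) := by
  rw [Finset.filter_true_of_mem, card_fixFinset_of_ne_one hp h h2, Nat.sum_range_multichoose]
  · obtain ⟨hd, -, hpm⟩ := exists_mul_orderOf_eq hp h.2 h2
    rw [div_eq_of_eq_mul_add_one hd hpm, two_mul]
  · intro M hM
    rw [mem_fixFinset] at hM
    exact moment_eq_zero_of_invariant hp h h2 M hM.2 (by rw [hM.1])

theorem coeff_invOneSubPowSeries_one_one (n : ℕ) : coeff n (invOneSubPowSeries ℚ 1 1) = 1 := by
  simp [coeff_invOneSubPowSeries]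

theorem coeff_two_one_of_even (n : ℕ) (hn : Even n) : coeff n (invOneSubPowSeries ℚ 2 1) = 1 := by
  simp [coeff_invOneSubPowSeries, hn.two_dvd]

/-- The unsigned half of the parity average, for `1 / ((1 - X) * (1 - X ^ d) ^ m)`. -/
theorem coeff_sq_mul_invOneSubPowSeries (d m P : ℕ) (hd : 0 < d) :
    coeff (2 * P) ((invOneSubPowSeries ℚ 1 1 * invOneSubPowSeries ℚ d m) *
      (invOneSubPowSeries ℚ 1 1 * invOneSubPowSeries ℚ d m)) =
    ∑ T ∈ Finset.range (2 * P / d + 1),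
      (Nat.multichoose (2 * m) T : ℚ) * (((2 * P - d * T : ℕ) : ℚ) + 1) := by
  rw [mul_mul_mul_comm, invOneSubPowSeries_mul _ _ _ one_pos, invOneSubPowSeries_mul _ _ _ hd,
    coeff_mul_invOneSubPowSeries _ _ _ _ hd, ← two_mul]
  refine Finset.sum_congr rfl fun T _ => ?_
  rw [coeff_invOneSubPowSeries]
  simp

theorem coeff_rescale_mul_of_even (d m P : ℕ) (hd : 0 < d) (he : Even d) :
    coeff (2 * P) (rescale (-1) (invOneSubPowSeries ℚ 1 1 * invOneSubPowSeries ℚ d m) *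
      (invOneSubPowSeries ℚ 1 1 * invOneSubPowSeries ℚ d m)) =
    ∑ T ∈ Finset.range (2 * P / d + 1), (Nat.multichoose (2 * m) T : ℚ) := by
  rw [map_mul (rescale (-1)), mul_mul_mul_comm,
    rescale_neg_one_mul_invOneSubPowSeries_of_odd _ _ odd_one,
    rescale_neg_one_invOneSubPowSeries_of_even _ _ he, invOneSubPowSeries_mul _ _ _ hd,
    coeff_mul_invOneSubPowSeries _ _ _ _ hd, ← two_mul]
  refine Finset.sum_congr rfl fun T _ => ?_
  rw [mul_one, coeff_two_one_of_even, mul_one]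
  obtain ⟨e, rfl⟩ := he
  rw [← two_mul, mul_assoc, ← Nat.mul_sub]
  exact even_two_mul _

theorem coeff_rescale_mul_of_odd (d m P : ℕ) (hd : Odd d) :
    coeff (2 * P) (rescale (-1) (invOneSubPowSeries ℚ 1 1 * invOneSubPowSeries ℚ d m) *
      (invOneSubPowSeries ℚ 1 1 * invOneSubPowSeries ℚ d m)) =
    ∑ T ∈ Finset.range (P / d + 1), (Nat.multichoose m T : ℚ) := by
  have hd0 := hd.pos
  rw [map_mul (rescale (-1)), mul_mul_mul_comm,
    rescale_neg_one_mul_invOneSubPowSeries_of_odd _ _ odd_one,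
    rescale_neg_one_mul_invOneSubPowSeries_of_odd _ _ hd,
    coeff_mul_invOneSubPowSeries _ _ _ _ (by positivity), Nat.mul_div_mul_left _ _ two_pos]
  refine Finset.sum_congr rfl fun T _ => ?_
  rw [mul_one, coeff_two_one_of_even, mul_one]
  rw [mul_assoc, ← Nat.mul_sub]
  exact even_two_mul _

theorem two_mul_evenPairCount_of_ne_one (hp : p.Prime) (hodd : Odd p) (h : DirectProd p)
    (h2 : h.2 ≠ 1) (d m : ℕ) (hd : orderOf h.2 = d) (hm : (p - 1) / d = m) :
    (2 * evenPairCount p (subscriptPerm p h) : ℚ) =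
      ∑ T ∈ Finset.range (2 * p / d + 1),
        (Nat.multichoose (2 * m) T : ℚ) * (((2 * p - d * T : ℕ) : ℚ) + 1) +
      if Even d then ∑ T ∈ Finset.range (2 * p / d + 1), (Nat.multichoose (2 * m) T : ℚ)
      else ∑ T ∈ Finset.range (p / d + 1), (Nat.multichoose m T : ℚ) := by
  have hd0 : 0 < d := by
    have := exists_mul_orderOf_eq hp h.2 h2
    omega
  rw [two_mul_evenPairCount hp hodd h (fun hh => h2 (by rw [hh]; rfl))
    (invOneSubPowSeries ℚ 1 1 * invOneSubPowSeries ℚ d m),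
    coeff_sq_mul_invOneSubPowSeries _ _ _ hd0]
  · congr 1
    split_ifs with he
    · exact coeff_rescale_mul_of_even _ _ _ hd0 he
    · exact coeff_rescale_mul_of_odd _ _ _ (Nat.not_even_iff_odd.1 he)
  · intro n
    rw [coeff_mul_invOneSubPowSeries _ _ _ _ hd0, card_fixFinset_of_ne_one hp h h2, hd, hm]
    push_cast
    exact Finset.sum_congr rfl fun T _ => by rw [coeff_invOneSubPowSeries_one_one, mul_one]

/-- A multiplier of order two is `-1`. Here `2 * p / 2 = p` exceeds `2 * m = p - 1`, so the two
units of mass at the fixed points can also go to an orbit; this is why the order two is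
exceptional. -/
theorem evenPairCount_of_orderOf_eq_two (hp : p.Prime) (hodd : Odd p) (h : DirectProd p)
    (hd : orderOf h.2 = 2) : evenPairCount p (subscriptPerm p h) = (2 * p).choose p := by
  have h2 : h.2 ≠ 1 := fun h => by simp [h] at hd
  have h3 := two_mul_evenPairCount_of_ne_one hp hodd h h2 2 _ hd rfl
  obtain ⟨m, hm⟩ := hodd
  have hm' : (p - 1) / 2 = m := by omega
  rw [if_pos even_two, hm', Nat.mul_div_cancel_left _ two_pos, ← Finset.sum_add_distrib] at h3
  have h4 := sum_multichoose_mul_sub (2 * m) (p + 1)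
  rw [Finset.sum_range_succ, Nat.sub_self, mul_zero, add_zero,
    show p + 1 + 2 * m = 2 * p by omega, ← hm] at h4
  have h5 : (2 * evenPairCount p (subscriptPerm p h) : ℚ) = 2 * ((2 * p).choose p : ℕ) := by
    rw [h3, ← h4]
    push_cast
    rw [Finset.mul_sum]
    refine Finset.sum_congr rfl fun T hT => ?_
    rw [Finset.mem_range_succ_iff] at hT
    rw [Nat.cast_sub (by omega), Nat.cast_sub (by omega)]
    push_cast
    ring
  have h6 : (evenPairCount p (subscriptPerm p h) : ℚ) = ((2 * p).choose p : ℕ) := by linarith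
  exact_mod_cast h6

/-- With `p = d * m + 1` and `d > 2`, at most `2 * m` units of orbit mass fit into `2 * p`. The
sums over the number `T` of such units are hockey-stick sums. -/
theorem evenPairCount_of_two_lt_orderOf (hp : p.Prime) (hodd : Odd p) (h : DirectProd p)
    (d m : ℕ) (hd : orderOf h.2 = d) (hm : (p - 1) / d = m) (hd2 : 2 < d) :
    (evenPairCount p (subscriptPerm p h) : ℚ) =
      ((((p : ℚ) + 4 * (m : ℚ) + 1) / (2 * (m : ℚ) + 1)
          - (1 - (-1 : ℚ) ^ d) / 4) * (Nat.choose (4 * m) (2 * m) : ℚ)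
        + (1 - (-1 : ℚ) ^ d) / 4 * (Nat.choose (2 * m) m : ℚ)) := by
  have h2 : h.2 ≠ 1 := fun h => by simp [h] at hd; omega
  have h3 := two_mul_evenPairCount_of_ne_one hp hodd h h2 d m hd hm
  obtain ⟨-, -, hpm⟩ := exists_mul_orderOf_eq hp h.2 h2
  rw [hd, hm] at hpm
  have hq1 : p / d = m := div_eq_of_eq_mul_add_one hd2.le hpm
  have hq2 : 2 * p / d = 2 * m := by
    rw [hpm, show 2 * (d * m + 1) = d * (2 * m) + 2 by ring, Nat.mul_add_div (by omega),
      Nat.div_eq_of_lt (by omega), add_zero]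
  have hA : ∑ T ∈ Finset.range (2 * m + 1), (Nat.multichoose (2 * m) T : ℚ) =
      (Nat.choose (4 * m) (2 * m) : ℚ) := by
    rw [← Nat.cast_sum, Nat.sum_range_multichoose]
    congr 2
    ring
  have hB : ∑ T ∈ Finset.range (m + 1), (Nat.multichoose m T : ℚ) =
      (Nat.choose (2 * m) m : ℚ) := by
    rw [← Nat.cast_sum, Nat.sum_range_multichoose, two_mul]
  have hC : ∑ T ∈ Finset.range (2 * m + 1), (Nat.multichoose (2 * m) T : ℚ) * (2 * m - T) =
      (Nat.choose (4 * m) (2 * m) : ℚ) * (2 * m / (2 * m + 1)) := by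
    have h4 := sum_multichoose_mul_sub (2 * m) (2 * m)
    have h5 := Nat.choose_succ_right_eq (2 * m + 2 * m) (2 * m)
    rw [← h4, Nat.add_sub_cancel, show 2 * m + 2 * m = 4 * m by ring] at h5
    have h6 : (∑ T ∈ Finset.range (2 * m + 1), (Nat.multichoose (2 * m) T : ℚ) * (2 * m - T)) *
        (2 * m + 1) = (Nat.choose (4 * m) (2 * m) : ℚ) * (2 * m) := by
      rw [Finset.sum_congr rfl
        (g := fun T => ((Nat.multichoose (2 * m) T * (2 * m - T) : ℕ) : ℚ))]
      · exact_mod_cast h5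
      · intro T hT
        rw [Finset.mem_range_succ_iff] at hT
        rw [Nat.cast_mul, Nat.cast_sub hT]
        push_cast
        rfl
    rw [← mul_div_assoc, ← h6]
    field_simp
  have hD : ∑ T ∈ Finset.range (2 * m + 1),
      (Nat.multichoose (2 * m) T : ℚ) * (((2 * p - d * T : ℕ) : ℚ) + 1) =
      d * ((Nat.choose (4 * m) (2 * m) : ℚ) * (2 * m / (2 * m + 1))) +
        3 * (Nat.choose (4 * m) (2 * m) : ℚ) := by
    rw [← hC, ← hA, Finset.mul_sum, Finset.mul_sum, ← Finset.sum_add_distrib]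
    refine Finset.sum_congr rfl fun T hT => ?_
    rw [Finset.mem_range_succ_iff] at hT
    have hT' := Nat.mul_le_mul_left d hT
    have hle : d * T ≤ 2 * p := by
      rw [hpm]; linarith
    rw [Nat.cast_sub hle, hpm]
    push_cast
    ring
  have hpq : (p : ℚ) = d * m + 1 := by exact_mod_cast hpm
  rw [hq1, hq2, hA, hB, hD] at h3
  have hm0 : (2 * (m : ℚ) + 1) ≠ 0 := by positivity
  split_ifs at h3 with he
  · rw [he.neg_one_pow, hpq]
    have h7 : (evenPairCount p (subscriptPerm p h) : ℚ) =
      (d * ((Nat.choose (4 * m) (2 * m) : ℚ) * (2 * m / (2 * m + 1))) +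
        4 * (Nat.choose (4 * m) (2 * m) : ℚ)) / 2 := by linarith
    rw [h7]
    field_simp
    ring
  · rw [(Nat.not_even_iff_odd.1 he).neg_one_pow, hpq]
    have h7 : (evenPairCount p (subscriptPerm p h) : ℚ) =
      (d * ((Nat.choose (4 * m) (2 * m) : ℚ) * (2 * m / (2 * m + 1))) +
        3 * (Nat.choose (4 * m) (2 * m) : ℚ) + (Nat.choose (2 * m) m : ℚ)) / 2 := by linarith
    rw [h7]
    field_simp
    ring

end CharacterSums

/-! ### Summation over the affine group modulo a prime -/

section Prime

variable {p : ℕ} [NeZero p]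

/-- The unit group is cyclic, so each order `d = (p - 1) / m` occurs `φ d` times. -/
theorem sum_ne_one_orderOf (hp : p.Prime) (f : ℕ → ℚ) :
    ∑ b : {b : (ZMod p)ˣ // b ≠ 1}, f (orderOf b.1) =
      ∑ m ∈ (p - 1).divisors with m < p - 1,
        (Nat.totient ((p - 1) / m) : ℚ) * f ((p - 1) / m) := by
  classical
  have : Fact p.Prime := ⟨hp⟩
  have hc : Fintype.card (ZMod p)ˣ = p - 1 := by
    rw [ZMod.card_units_eq_totient, Nat.totient_prime hp]
  have hp1 : p - 1 ≠ 0 := by have := hp.two_le; omega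
  let g : ℕ → ℚ := fun d => if d = 1 then 0 else f d
  have h1 : ∑ b : {b : (ZMod p)ˣ // b ≠ 1}, f (orderOf b.1) = ∑ b : (ZMod p)ˣ, g (orderOf b) := by
    rw [Fintype.sum_eq_add_sum_subtype_ne (fun b => g (orderOf b)) 1]
    simp only [g, orderOf_one, if_true, zero_add]
    exact Finset.sum_congr rfl fun b _ => by rw [if_neg (by rw [orderOf_eq_one_iff]; exact b.2)]
  have h2 : ∑ b : (ZMod p)ˣ, g (orderOf b) =
      ∑ d ∈ (p - 1).divisors, (Nat.totient d : ℚ) * g d := by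
    rw [← Finset.sum_fiberwise_of_maps_to (g := fun b : (ZMod p)ˣ => orderOf b)
      (t := (p - 1).divisors)
      (fun b _ => Nat.mem_divisors.2 ⟨hc ▸ orderOf_dvd_card, hp1⟩)]
    refine Finset.sum_congr rfl fun d hd => ?_
    rw [Finset.sum_congr rfl (g := fun _ => g d)
      (fun b hb => by rw [(Finset.mem_filter.1 hb).2]), Finset.sum_const, nsmul_eq_mul,
      IsCyclic.card_orderOf_eq_totient (hc ▸ Nat.dvd_of_mem_divisors hd)]
  rw [h1, h2, ← Nat.sum_div_divisors, Finset.sum_filter]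
  refine Finset.sum_congr rfl fun m hm => ?_
  have hmd := Nat.dvd_of_mem_divisors hm
  have hle := Nat.le_of_dvd (Nat.pos_of_ne_zero hp1) hmd
  have hiff : (p - 1) / m = 1 ↔ m = p - 1 := by
    rw [Nat.div_eq_iff_eq_mul_left (Nat.pos_of_mem_divisors hm) hmd, one_mul, eq_comm]
  by_cases hlt : m < p - 1
  · rw [if_pos hlt]
    simp only [g]
    rw [if_neg (fun h => hlt.ne (hiff.1 h))]
  · rw [if_neg hlt]
    simp only [g]
    rw [if_pos (hiff.2 (by omega)), mul_zero]

/-- There are `p - 1` nontrivial translations, and `p` maps for each multiplier `b ≠ 1`. -/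
theorem sum_directProd_eq (hp : p.Prime) (F : DirectProd p → ℚ) (c0 c1 : ℚ) (f : ℕ → ℚ)
    (h0 : F 1 = c0) (h1 : ∀ h : DirectProd p, h.1 ≠ 1 → h.2 = 1 → F h = c1)
    (h2 : ∀ h : DirectProd p, h.2 ≠ 1 → F h = f (orderOf h.2)) :
    ∑ h, F h = c0 + (p - 1) * c1 + p * ∑ m ∈ (p - 1).divisors with m < p - 1,
        (Nat.totient ((p - 1) / m) : ℚ) * f ((p - 1) / m) := by
  rw [← sum_ne_one_orderOf hp, Fintype.sum_prod_type_right, Fintype.sum_eq_add_sum_subtype_ne _ 1]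
  congr 1
  · rw [Fintype.sum_eq_add_sum_subtype_ne _ 1]
    congr 1
    rw [Finset.sum_congr rfl (g := fun _ => c1) (fun a _ => h1 _ a.2 rfl), Finset.sum_const,
      Finset.card_univ, nsmul_eq_mul]
    congr 1
    simp [Fintype.card_subtype_compl, ZMod.card, Nat.cast_sub (NeZero.one_le : 1 ≤ p)]
  · rw [Finset.mul_sum]
    refine Finset.sum_congr rfl fun b _ => ?_
    rw [Finset.sum_congr rfl (g := fun _ => f (orderOf b.1)) (fun a _ => h2 (a, b.1) b.2),
      Finset.sum_const, Finset.card_univ, nsmul_eq_mul, Fintype.card_multiplicative, ZMod.card]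

/-- A quantity that only distinguishes translations by whether they are trivial, and other affine
maps by the order of the multiplier, depends only on the subgroup generated in the direct
product. -/
theorem eq_of_zpowers_eq {p : ℕ} {α : Type*} (F : DirectProd p → α) (c1 : α) (f : ℕ → α)
    (h1 : ∀ h : DirectProd p, h.1 ≠ 1 → h.2 = 1 → F h = c1)
    (h2 : ∀ h : DirectProd p, h.2 ≠ 1 → F h = f (orderOf h.2))
    (g g' : DirectProd p) (hgg : Subgroup.zpowers g = Subgroup.zpowers g') : F g = F g' := by
  have e1 : Subgroup.zpowers g.1 = Subgroup.zpowers g'.1 := by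
    have := congrArg (Subgroup.map (MonoidHom.fst _ _)) hgg
    rwa [MonoidHom.map_zpowers, MonoidHom.map_zpowers] at this
  have e2 : Subgroup.zpowers g.2 = Subgroup.zpowers g'.2 := by
    have := congrArg (Subgroup.map (MonoidHom.snd _ _)) hgg
    rwa [MonoidHom.map_zpowers, MonoidHom.map_zpowers] at this
  have i1 : g.1 = 1 ↔ g'.1 = 1 := by
    rw [← Subgroup.zpowers_eq_bot, e1, Subgroup.zpowers_eq_bot]
  have i2 : g.2 = 1 ↔ g'.2 = 1 := by
    rw [← Subgroup.zpowers_eq_bot, e2, Subgroup.zpowers_eq_bot]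
  have i3 : orderOf g.2 = orderOf g'.2 := by rw [← Nat.card_zpowers, e2, Nat.card_zpowers]
  by_cases k2 : g.2 = 1
  · by_cases k1 : g.1 = 1
    · have e : g = 1 := Prod.ext k1 k2
      have e' : g' = 1 := Prod.ext (i1.1 k1) (i2.1 k2)
      rw [e, e']
    · rw [h1 g k1 k2, h1 g' (mt i1.2 k1) (i2.1 k2)]
  · rw [h2 g k2, h2 g' (mt i2.2 k2), i3]

theorem isCyclic_directProd_prime (hp : p.Prime) : IsCyclic (DirectProd p) := by
  have : Fact p.Prime := ⟨hp⟩
  rw [Group.isCyclic_prod_iff]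
  refine ⟨inferInstance, inferInstance, ?_⟩
  rw [Nat.card_eq_fintype_card, Nat.card_eq_fintype_card, Fintype.card_multiplicative, ZMod.card,
    ZMod.card_units_eq_totient, Nat.totient_prime hp]
  have := hp.two_le
  exact (Nat.coprime_self_sub_right (by omega)).2 (Nat.coprime_one_right p)

theorem subscriptPerm_one (N : ℕ) : subscriptPerm N 1 = 1 := by
  ext k
  simp [subscriptPerm]

theorem numInvariant_prime (h : DirectProd p) :
    numInvariant p {h} =
      ((fixFinset p (subscriptPerm p h) p).filter fun M => moment p M = 0).card := by
  rw [numInvariant, ← Set.ncard_coe_finset]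
  congr 1
  ext M
  simp only [IsIndexSet, Set.mem_singleton_iff, forall_eq, Set.mem_ofPred_eq, SetLike.mem_coe,
    Finset.mem_filter, mem_fixFinset]
  exact and_right_comm

theorem multichoose_self_eq_half (n : ℕ) (hn : 0 < n) :
    (Nat.multichoose n n : ℚ) = (Nat.choose (2 * n) n : ℚ) / 2 := by
  obtain ⟨k, rfl⟩ : ∃ k, n = k + 1 := ⟨n - 1, by omega⟩
  rw [Nat.multichoose_eq, show k + 1 + (k + 1) - 1 = 2 * k + 1 by omega,
    show 2 * (k + 1) = (2 * k + 1) + 1 by ring, Nat.choose_succ_succ (2 * k + 1) k,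
    Nat.succ_eq_add_one, Nat.choose_symm_half]
  push_cast
  ring

end Prime

/-! ### Reduction modulo two and modulo `p` -/

section TwoMulPrime

variable {p : ℕ}

/-- The splitting of the integers modulo `2 * p` for odd `p`. -/
def crt (hodd : Odd p) : ZMod (2 * p) ≃+* ZMod 2 × ZMod p :=
  ZMod.chineseRemainder (Nat.coprime_two_left.2 hodd)

/-- The parity of the translation part. -/
def parityHom (hodd : Odd p) : DirectProd (2 * p) →* Multiplicative (ZMod 2) :=
  (AddMonoidHom.toMultiplicative
    ((RingHom.fst (ZMod 2) (ZMod p)).comp (crt hodd).toRingHom).toAddMonoidHom).comp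
      (MonoidHom.fst _ _)

/-- Reduction modulo `p` of both components. -/
def reductionHom (hodd : Odd p) : DirectProd (2 * p) →* DirectProd p :=
  MonoidHom.prodMap
    (AddMonoidHom.toMultiplicative
      ((RingHom.snd (ZMod 2) (ZMod p)).comp (crt hodd).toRingHom).toAddMonoidHom)
    (Units.map ((RingHom.snd (ZMod 2) (ZMod p)).comp (crt hodd).toRingHom).toMonoidHom)

theorem parityHom_apply (hodd : Odd p) (h : DirectProd (2 * p)) :
    Multiplicative.toAdd (parityHom hodd h) = (crt hodd (Multiplicative.toAdd h.1)).1 := rfl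

theorem reductionHom_fst (hodd : Odd p) (h : DirectProd (2 * p)) :
    Multiplicative.toAdd (reductionHom hodd h).1 = (crt hodd (Multiplicative.toAdd h.1)).2 := rfl

theorem reductionHom_snd (hodd : Odd p) (h : DirectProd (2 * p)) :
    ((reductionHom hodd h).2 : ZMod p) = (crt hodd (h.2 : ZMod (2 * p))).2 := rfl

theorem crt_unit_fst (hodd : Odd p) (u : (ZMod (2 * p))ˣ) :
    (crt hodd (u : ZMod (2 * p))).1 = 1 := by
  have h : IsUnit (crt hodd (u : ZMod (2 * p))).1 :=
    (u.isUnit.map (crt hodd)).map (RingHom.fst (ZMod 2) (ZMod p))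
  have key : ∀ x : ZMod 2, IsUnit x → x = 1 := by decide
  exact key _ h

theorem crt_subscriptPerm (hodd : Odd p) (h : DirectProd (2 * p)) (x : ZMod (2 * p)) :
    crt hodd (subscriptPerm (2 * p) h x) =
      ((crt hodd x).1 - Multiplicative.toAdd (parityHom hodd h),
        subscriptPerm p (reductionHom hodd h) (crt hodd x).2) := by
  change crt hodd (x * ((h.2⁻¹ : (ZMod (2 * p))ˣ) : ZMod (2 * p)) - Multiplicative.toAdd h.1) = _
  rw [map_sub, map_mul]
  refine Prod.ext ?_ ?_
  · rw [Prod.fst_sub, Prod.fst_mul, crt_unit_fst, mul_one]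
    rfl
  · rw [Prod.snd_sub, Prod.snd_mul]
    rfl

/-- The restrictions of a function to the odd and to the even residues. -/
def splitFun (hodd : Odd p) : (ZMod (2 * p) → ℕ) ≃ (ZMod p → ℕ) × (ZMod p → ℕ) where
  toFun M := (fun k => M ((crt hodd).symm (1, k)), fun k => M ((crt hodd).symm (0, k)))
  invFun P x := if (crt hodd x).1 = 1 then P.1 (crt hodd x).2 else P.2 (crt hodd x).2
  left_inv M := by
    funext x
    have key : ∀ i : ZMod 2, i ≠ 1 → i = 0 := by decide
    dsimp only
    split_ifs with h
    · rw [← h, Prod.mk.eta, RingEquiv.symm_apply_apply]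
    · rw [← key _ h, Prod.mk.eta, RingEquiv.symm_apply_apply]
  right_inv P := by
    refine Prod.ext ?_ ?_ <;> funext k <;> simp

theorem symmOp_eq_iff_splitFun (hodd : Odd p) (h : DirectProd (2 * p))
    (hpar : parityHom hodd h = 1) (M : ZMod (2 * p) → ℕ) :
    symmOp (2 * p) h M = M ↔
      (splitFun hodd M).1 ∘ subscriptPerm p (reductionHom hodd h) = (splitFun hodd M).1 ∧
        (splitFun hodd M).2 ∘ subscriptPerm p (reductionHom hodd h) = (splitFun hodd M).2 := by
  have hact : ∀ i k, subscriptPerm (2 * p) h ((crt hodd).symm (i, k)) =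
      (crt hodd).symm (i, subscriptPerm p (reductionHom hodd h) k) := by
    intro i k
    rw [RingEquiv.eq_symm_apply, crt_subscriptPerm, hpar]
    simp
  rw [← (splitFun hodd).injective.eq_iff, Prod.ext_iff]
  have e1 : (splitFun hodd (symmOp (2 * p) h M)).1 =
      (splitFun hodd M).1 ∘ subscriptPerm p (reductionHom hodd h) :=
    funext fun k => congrArg M (hact 1 k)
  have e2 : (splitFun hodd (symmOp (2 * p) h M)).2 =
      (splitFun hodd M).2 ∘ subscriptPerm p (reductionHom hodd h) :=
    funext fun k => congrArg M (hact 0 k)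
  rw [e1, e2]

theorem reductionHom_injective_of_parity (hodd : Odd p) (g h : DirectProd (2 * p))
    (hpar : parityHom hodd g = parityHom hodd h)
    (hred : reductionHom hodd g = reductionHom hodd h) :
    g = h := by
  refine Prod.ext ?_ ?_
  · refine Multiplicative.toAdd.injective ((crt hodd).injective (Prod.ext ?_ ?_))
    · exact congrArg Multiplicative.toAdd hpar
    · exact congrArg (fun x => Multiplicative.toAdd x.1) hred
  · refine Units.ext ((crt hodd).injective (Prod.ext ?_ ?_))
    · rw [crt_unit_fst, crt_unit_fst]
    · exact congrArg (fun x : DirectProd p => ((x.2 : (ZMod p)ˣ) : ZMod p)) hred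

theorem exists_parity_one_reduction (hodd : Odd p) (h : DirectProd p) :
    ∃ g : DirectProd (2 * p), parityHom hodd g = 1 ∧ reductionHom hodd g = h := by
  refine ⟨(Multiplicative.ofAdd ((crt hodd).symm (0, Multiplicative.toAdd h.1)),
    Units.map (crt hodd).symm.toRingHom.toMonoidHom (MulEquiv.prodUnits.symm (1, h.2))), ?_, ?_⟩
  · refine Multiplicative.toAdd.injective ?_
    rw [parityHom_apply]
    simp
  · refine Prod.ext (Multiplicative.toAdd.injective ?_) (Units.ext ?_)
    · rw [reductionHom_fst]
      simp
    · rw [reductionHom_snd]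
      simp
      rfl

variable [NeZero p]

theorem sum_crt {A : Type*} [AddCommMonoid A] (hodd : Odd p) (g : ZMod (2 * p) → A) :
    ∑ x, g x = ∑ k, g ((crt hodd).symm (1, k)) + ∑ k, g ((crt hodd).symm (0, k)) := by
  rw [← Equiv.sum_comp (crt hodd).symm.toEquiv, Fintype.sum_prod_type]
  have h : ∀ f : ZMod 2 → A, ∑ i, f i = f 1 + f 0 := fun f =>
    (Fin.sum_univ_two f).trans (add_comm _ _)
  exact h _

theorem isIndexSet_iff_splitFun (hodd : Odd p) (M : ZMod (2 * p) → ℕ) :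
    IsIndexSet (2 * p) M ↔
      ∑ k, (splitFun hodd M).1 k + ∑ k, (splitFun hodd M).2 k = 2 * p ∧
        Even (∑ k, (splitFun hodd M).1 k) ∧
          moment p (splitFun hodd M).1 + moment p (splitFun hodd M).2 = 0 := by
  have hs : ∑ x, M x = ∑ k, (splitFun hodd M).1 k + ∑ k, (splitFun hodd M).2 k := sum_crt hodd M
  have hm : crt hodd (∑ x, x * (M x : ZMod (2 * p))) =
      (((∑ k, (splitFun hodd M).1 k : ℕ) : ZMod 2),
        moment p (splitFun hodd M).1 + moment p (splitFun hodd M).2) := by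
    rw [sum_crt hodd, map_add, map_sum, map_sum]
    simp only [map_mul, map_natCast, RingEquiv.apply_symm_apply]
    refine Prod.ext ?_ ?_
    · simp [Prod.fst_sum, splitFun]
    · simp [Prod.snd_sum, splitFun, moment]
  rw [IsIndexSet, hs, ← (crt hodd).map_eq_zero_iff, hm, Prod.mk_eq_zero, ZMod.natCast_eq_zero_iff,
    even_iff_two_dvd]

/-- An odd translation part exchanges the even and the odd residues. Both then have total
mass `p`, which is odd, so the moment is odd. -/
theorem symmOp_ne_of_parityHom_ne_one (hodd : Odd p) (h : DirectProd (2 * p))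
    (hpar : parityHom hodd h ≠ 1) (M : ZMod (2 * p) → ℕ) (hM : IsIndexSet (2 * p) M) :
    symmOp (2 * p) h M ≠ M := by
  intro hinv
  have hpar' : Multiplicative.toAdd (parityHom hodd h) = (1 : ZMod 2) := by
    have key : ∀ i : ZMod 2, i ≠ 0 → i = 1 := by decide
    exact key _ fun h0 => hpar (Multiplicative.toAdd.injective h0)
  have e1 : (splitFun hodd M).1 =
      (splitFun hodd M).2 ∘ subscriptPerm p (reductionHom hodd h) := by
    funext k
    conv_lhs => rw [← hinv]
    refine congrArg M ?_
    rw [RingEquiv.eq_symm_apply, crt_subscriptPerm, hpar']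
    simp
  obtain ⟨h1, h2, -⟩ := (isIndexSet_iff_splitFun hodd M).1 hM
  have e2 : ∑ k, (splitFun hodd M).1 k = ∑ k, (splitFun hodd M).2 k := by
    rw [e1]
    exact Equiv.sum_comp _ (splitFun hodd M).2
  have e3 : ∑ k, (splitFun hodd M).1 k = p := by omega
  rw [e3] at h2
  exact Nat.not_even_iff_odd.2 hodd h2

theorem numInvariant_two_mul (hodd : Odd p) [NeZero (2 * p)] (h : DirectProd (2 * p)) :
    numInvariant (2 * p) {h} =
      if parityHom hodd h = 1 then evenPairCount p (subscriptPerm p (reductionHom hodd h))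
      else 0 := by
  classical
  split_ifs with hpar
  · set σ := subscriptPerm p (reductionHom hodd h) with hσ
    let s : Finset (ℕ × ℕ) :=
      (Finset.HasAntidiagonal.antidiagonal (2 * p)).filter fun ij => Even ij.1
    let B : ℕ × ℕ → Finset ((ZMod p → ℕ) × (ZMod p → ℕ)) := fun ij =>
      (fixFinset p σ ij.1 ×ˢ fixFinset p σ ij.2).filter fun M => moment p M.1 + moment p M.2 = 0
    have hB : evenPairCount p σ = (s.biUnion B).card := by
      rw [Finset.card_biUnion]
      · rfl
      · intro ij _ kl _ hne
        rw [Function.onFun, Finset.disjoint_left]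
        intro M hM hM'
        simp only [B, Finset.mem_filter, Finset.mem_product, mem_fixFinset] at hM hM'
        exact hne (Prod.ext (hM.1.1.1.symm.trans hM'.1.1.1) (hM.1.2.1.symm.trans hM'.1.2.1))
    rw [hB, numInvariant, ← Set.ncard_coe_finset,
      ← Set.ncard_image_of_injective _ (splitFun hodd).injective]
    congr 1
    rw [Equiv.image_eq_preimage_symm]
    ext P
    obtain ⟨M, rfl⟩ := (splitFun hodd).surjective P
    simp only [Set.mem_preimage, Equiv.symm_apply_apply, Set.mem_ofPred_eq,
      Set.mem_singleton_iff, forall_eq, isIndexSet_iff_splitFun hodd,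
      symmOp_eq_iff_splitFun hodd h hpar, SetLike.mem_coe, Finset.mem_biUnion, B, s,
      Finset.mem_filter, Finset.HasAntidiagonal.mem_antidiagonal, Finset.mem_product,
      mem_fixFinset, Prod.exists]
    constructor
    · rintro ⟨⟨h1, h2, h3⟩, h4, h5⟩
      exact ⟨_, _, ⟨h1, h2⟩, ⟨⟨rfl, h4⟩, rfl, h5⟩, h3⟩
    · rintro ⟨i, j, ⟨h1, h2⟩, ⟨⟨rfl, h4⟩, rfl, h5⟩, h3⟩
      exact ⟨⟨h1, h2, h3⟩, h4, h5⟩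
  · rw [numInvariant]
    convert Set.ncard_empty (α := ZMod (2 * p) → ℕ)
    rw [Set.eq_empty_iff_forall_notMem]
    rintro M ⟨hM, hinv⟩
    exact symmOp_ne_of_parityHom_ne_one hodd h hpar M hM (hinv h rfl)

theorem sum_numInvariant_two_mul (hodd : Odd p) [NeZero (2 * p)] :
    ∑ h : DirectProd (2 * p), (numInvariant (2 * p) {h} : ℚ) =
      ∑ h : DirectProd p, (evenPairCount p (subscriptPerm p h) : ℚ) := by
  classical
  simp_rw [numInvariant_two_mul hodd, Nat.cast_ite, Nat.cast_zero]
  rw [← Finset.sum_filter]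
  refine Finset.sum_bij (fun h _ => reductionHom hodd h) (fun _ _ => Finset.mem_univ _) ?_ ?_ ?_
  · intro g hg h hh hgh
    exact reductionHom_injective_of_parity hodd g h
      ((Finset.mem_filter.1 hg).2.trans (Finset.mem_filter.1 hh).2.symm) hgh
  · intro h _
    obtain ⟨g, h1, h2⟩ := exists_parity_one_reduction hodd h
    exact ⟨g, Finset.mem_filter.2 ⟨Finset.mem_univ _, h1⟩, h2⟩
  · intro h _
    rfl

/-- The elements with even translation part form a cyclic group, so generators of a non-cyclic
subgroup include one with odd translation part. -/
theorem numInvariant_two_mul_of_not_isCyclic (hp : p.Prime) (hodd : Odd p) [NeZero (2 * p)]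
    (T : Set (DirectProd (2 * p))) (hT : ¬ IsCyclic (Subgroup.closure T)) :
    numInvariant (2 * p) T = 0 := by
  obtain ⟨h, hh, hpar⟩ : ∃ h ∈ T, parityHom hodd h ≠ 1 := by
    by_contra! hcon
    refine hT ?_
    have hker : Subgroup.closure T ≤ (parityHom hodd).ker :=
      (Subgroup.closure_le _).2 fun h hh => hcon h hh
    have := isCyclic_directProd_prime hp
    refine isCyclic_of_injective ((reductionHom hodd).comp (Subgroup.closure T).subtype) ?_
    intro g h hgh
    exact Subtype.ext (reductionHom_injective_of_parity hodd g.1 h.1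
      ((hker g.2).trans (hker h.2).symm) hgh)
  rw [numInvariant]
  convert Set.ncard_empty (α := ZMod (2 * p) → ℕ)
  rw [Set.eq_empty_iff_forall_notMem]
  rintro M ⟨hM, hinv⟩
  exact symmOp_ne_of_parityHom_ne_one hodd h hpar M hM (hinv h hh)

end TwoMulPrime

/-! ### Evaluation of the sums -/

theorem sum_numInvariant_prime (p : ℕ) [NeZero p] (hp : p.Prime) (hodd : Odd p) :
    ∑ h : DirectProd p, (numInvariant p {h} : ℚ) =
      1 / (2 * (p : ℚ)) * (Nat.choose (2 * p) p : ℚ) + ((p : ℚ) ^ 2 - 1) / (p : ℚ)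
          + (p : ℚ) * ∑ m ∈ (p - 1).divisors with m < p - 1,
              (Nat.totient ((p - 1) / m) : ℚ) * (Nat.choose (2 * m) m : ℚ) := by
  have hp0 : (p : ℚ) ≠ 0 := by exact_mod_cast hp.ne_zero
  have hid : (numInvariant p {(1 : DirectProd p)} : ℚ) =
      ((Nat.choose (2 * p) p : ℚ) / 2 + (p - 1)) / p := by
    rw [eq_div_iff hp0, mul_comm, numInvariant_prime, subscriptPerm_one,
      mul_card_filter_moment_one hp, multichoose_self_eq_half p hp.pos]
  rw [sum_directProd_eq hp (fun h => (numInvariant p {h} : ℚ)) _ 1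
    (fun d => (Nat.choose (2 * ((p - 1) / d)) ((p - 1) / d) : ℚ)) hid]
  · congr 1
    · field_simp
      ring
    · congr 1
      refine Finset.sum_congr rfl fun m hm => ?_
      have hm := Nat.mem_divisors.1 (Finset.mem_filter.1 hm).1
      rw [Nat.div_div_self hm.1 hm.2]
  · intro h h1 h2
    rw [numInvariant_prime, card_filter_moment_translation hp hodd h h1 h2, Nat.cast_one]
  · intro h h2
    rw [numInvariant_prime, card_filter_moment_of_ne_one hp h h2]

/-- The number of pairs fixed by an affine map whose multiplier has order `d > 1`, as a function
of `d` alone. -/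
noncomputable def evenPairValue (p d : ℕ) : ℚ :=
  if d = 2 then (Nat.choose (2 * p) p : ℚ)
  else (((p : ℚ) + 4 * (((p - 1) / d : ℕ) : ℚ) + 1) / (2 * (((p - 1) / d : ℕ) : ℚ) + 1)
      - (1 - (-1 : ℚ) ^ d) / 4) * (Nat.choose (4 * ((p - 1) / d)) (2 * ((p - 1) / d)) : ℚ)
    + (1 - (-1 : ℚ) ^ d) / 4 * (Nat.choose (2 * ((p - 1) / d)) ((p - 1) / d) : ℚ)

theorem evenPairCount_eq_value {p : ℕ} [NeZero p] (hp : p.Prime) (hodd : Odd p)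
    (h : DirectProd p) (h2 : h.2 ≠ 1) :
    (evenPairCount p (subscriptPerm p h) : ℚ) = evenPairValue p (orderOf h.2) := by
  unfold evenPairValue
  split_ifs with hd
  · rw [evenPairCount_of_orderOf_eq_two hp hodd h hd]
  · have := (exists_mul_orderOf_eq hp h.2 h2).1
    exact evenPairCount_of_two_lt_orderOf hp hodd h _ _ rfl rfl (by omega)

/-- The divisor `m = (p - 1) / 2`, which corresponds to involutions, is split off. -/
theorem sum_evenPairValue {p : ℕ} (hp : p.Prime) (hodd : Odd p) :
    ∑ m ∈ (p - 1).divisors with m < p - 1,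
        (Nat.totient ((p - 1) / m) : ℚ) * evenPairValue p ((p - 1) / m) =
      (Nat.choose (2 * p) p : ℚ) + ∑ m ∈ (p - 1).divisors with m < (p - 1) / 2,
              (Nat.totient ((p - 1) / m) : ℚ) *
                ((((p : ℚ) + 4 * (m : ℚ) + 1) / (2 * (m : ℚ) + 1)
                    - (1 - (-1 : ℚ) ^ ((p - 1) / m)) / 4) * (Nat.choose (4 * m) (2 * m) : ℚ)
                  + (1 - (-1 : ℚ) ^ ((p - 1) / m)) / 4 * (Nat.choose (2 * m) m : ℚ)) := by
  obtain ⟨k, hk⟩ := hodd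
  have hp2 := hp.two_le
  have hk0 : 0 < k := by omega
  have hpk : p - 1 = 2 * k := by omega
  have hsplit : ((p - 1).divisors.filter fun m => m < p - 1) =
      insert k ((p - 1).divisors.filter fun m => m < (p - 1) / 2) := by
    ext m
    simp only [Finset.mem_filter, Finset.mem_insert, Nat.mem_divisors, hpk]
    rw [Nat.mul_div_cancel_left _ two_pos]
    constructor
    · rintro ⟨⟨⟨q, hq⟩, h0⟩, hlt⟩
      have hq2 : 2 ≤ q := by
        by_contra! hq2
        interval_cases q <;> omega
      have : m * 2 ≤ m * q := Nat.mul_le_mul_left m hq2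
      by_cases hmk : m = k
      · exact Or.inl hmk
      · exact Or.inr ⟨⟨⟨q, hq⟩, h0⟩, by omega⟩
    · rintro (rfl | ⟨h, hlt⟩)
      · exact ⟨⟨dvd_mul_left _ _, by omega⟩, by omega⟩
      · exact ⟨h, by omega⟩
  rw [hsplit, Finset.sum_insert (by simp [hpk])]
  congr 1
  · rw [hpk, Nat.mul_div_cancel _ hk0, evenPairValue, if_pos rfl]
    simp
  · refine Finset.sum_congr rfl fun m hm => ?_
    obtain ⟨hm, hlt⟩ := Finset.mem_filter.1 hm
    obtain ⟨hmd, h0⟩ := Nat.mem_divisors.1 hm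
    have hne : (p - 1) / m ≠ 2 := by
      intro h
      have h3 := Nat.div_mul_cancel hmd
      rw [h] at h3
      omega
    rw [evenPairValue, if_neg hne, Nat.div_div_self hmd h0]

theorem sum_numInvariant_two_mul_prime (p : ℕ) [NeZero p] [NeZero (2 * p)] (hp : p.Prime)
    (hodd : Odd p) :
    ∑ h : DirectProd (2 * p), (numInvariant (2 * p) {h} : ℚ) =
      1 / (4 * (p : ℚ)) * (Nat.choose (4 * p) (2 * p) : ℚ)
          + (4 * (p : ℚ) ^ 2 + 1) / (4 * (p : ℚ)) * (Nat.choose (2 * p) p : ℚ)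
          + 2 * ((p : ℚ) ^ 2 - 1) / (p : ℚ)
          + (p : ℚ) * ∑ m ∈ (p - 1).divisors with m < (p - 1) / 2,
              (Nat.totient ((p - 1) / m) : ℚ) *
                ((((p : ℚ) + 4 * (m : ℚ) + 1) / (2 * (m : ℚ) + 1)
                    - (1 - (-1 : ℚ) ^ ((p - 1) / m)) / 4) * (Nat.choose (4 * m) (2 * m) : ℚ)
                  + (1 - (-1 : ℚ) ^ ((p - 1) / m)) / 4 * (Nat.choose (2 * m) m : ℚ)) := by
  have hp0 : (p : ℚ) ≠ 0 := by exact_mod_cast hp.ne_zero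
  have hid : (evenPairCount p (subscriptPerm p 1) : ℚ) =
      ((Nat.choose (4 * p) (2 * p) : ℚ) / 2 + (Nat.choose (2 * p) p : ℚ) / 2 + (p - 1) * 4)
        / (2 * p) := by
    have h := mul_evenPairCount_one hp hodd
    rw [multichoose_self_eq_half p hp.pos,
      multichoose_self_eq_half (2 * p) (by have := hp.pos; omega),
      show 2 * (2 * p) = 4 * p by ring] at h
    rw [subscriptPerm_one, eq_div_iff (by positivity), ← h]
    ring
  rw [sum_numInvariant_two_mul hodd,
    sum_directProd_eq hp (fun h => (evenPairCount p (subscriptPerm p h) : ℚ)) _ 2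
      (evenPairValue p) hid, sum_evenPairValue hp hodd]
  · generalize (Finset.sum ((p - 1).divisors.filter fun m => m < (p - 1) / 2) _ : ℚ) = S
    field_simp
    ring
  · intro h h1 h2
    rw [evenPairCount_translation hp hodd h h1 h2, Nat.cast_two]
  · exact evenPairCount_eq_value hp hodd

theorem numInvariant_eq_of_zpowers_eq (p : ℕ) (hp : p.Prime) (hodd : Odd p) (N : ℕ) [NeZero N]
    (hN : N = p ∨ N = 2 * p) (g g' : DirectProd N)
    (hgg : Subgroup.zpowers g = Subgroup.zpowers g') :
    numInvariant N {g} = numInvariant N {g'} := by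
  have : NeZero p := ⟨hp.ne_zero⟩
  rcases hN with rfl | rfl
  · refine eq_of_zpowers_eq (fun g => numInvariant N {g}) 1
      (fun d => (2 * ((N - 1) / d)).choose ((N - 1) / d)) ?_ ?_ g g' hgg
    · intro h h1 h2
      rw [numInvariant_prime, card_filter_moment_translation hp hodd h h1 h2]
    · intro h h2
      rw [numInvariant_prime, card_filter_moment_of_ne_one hp h h2]
  · have h1 := congrArg (Subgroup.map (parityHom hodd)) hgg
    have h2 := congrArg (Subgroup.map (reductionHom hodd)) hgg
    rw [MonoidHom.map_zpowers, MonoidHom.map_zpowers] at h1 h2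
    have h3 : parityHom hodd g = 1 ↔ parityHom hodd g' = 1 := by
      rw [← Subgroup.zpowers_eq_bot, h1, Subgroup.zpowers_eq_bot]
    have h4 := eq_of_zpowers_eq (fun h => (evenPairCount p (subscriptPerm p h) : ℚ)) 2
      (evenPairValue p)
      (fun h h1 h2 => by rw [evenPairCount_translation hp hodd h h1 h2, Nat.cast_two])
      (evenPairCount_eq_value hp hodd) _ _ h2
    rw [numInvariant_two_mul hodd, numInvariant_two_mul hodd, Nat.cast_inj.1 h4]
    simp only [h3]

theorem numInvariant_of_not_isCyclic (p : ℕ) (hp : p.Prime) (hodd : Odd p) (N : ℕ) [NeZero N]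
    (hN : N = p ∨ N = 2 * p) (T : Set (DirectProd N)) (hT : ¬ IsCyclic (Subgroup.closure T)) :
    numInvariant N T = 0 := by
  have : NeZero p := ⟨hp.ne_zero⟩
  rcases hN with rfl | rfl
  · have := isCyclic_directProd_prime hp
    exact absurd (inferInstance : IsCyclic (Subgroup.closure T)) hT
  · exact numInvariant_two_mul_of_not_isCyclic hp hodd T hT

theorem mainTheorem11 (p : ℕ) (hp : p.Prime) (hodd : Odd p)
    (N : ℕ) [NeZero N] (hN : N = p ∨ N = 2 * p) :
    (∀ T : Subgroup (DirectProd N) → Set (DirectProd N),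
        (∀ S, Subgroup.closure (T S) = S) →
        (∀ S : Subgroup (DirectProd N), IsCyclic S → ∃ g, T S = {g}) →
        (numSuperMultiplets N : ℚ) = 1 / ((N : ℚ) * (Nat.totient N : ℚ)) *
          ∑ᶠ S : Subgroup (DirectProd N),
            (Nat.totient (Nat.card S) : ℚ) * (numInvariant N (T S) : ℚ)) ∧
    ((numSuperMultiplets N : ℚ) = 1 / ((N : ℚ) * (Nat.totient N : ℚ)) *
      ∑ᶠ (S : Subgroup (Equiv.Perm (ZMod N))) (_ : S ≤ symmGroup N ∧ IsCyclic S),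
        (Nat.totient (Nat.card S) : ℚ) * (numInvariantSubgroup N S : ℚ)) ∧
    (N = p →
      (numSuperMultiplets N : ℚ) = 1 / ((p : ℚ) * ((p : ℚ) - 1)) *
        (1 / (2 * (p : ℚ)) * (Nat.choose (2 * p) p : ℚ) + ((p : ℚ) ^ 2 - 1) / (p : ℚ)
          + (p : ℚ) * ∑ m ∈ (p - 1).divisors with m < p - 1,
              (Nat.totient ((p - 1) / m) : ℚ) * (Nat.choose (2 * m) m : ℚ))) ∧
    (N = 2 * p →
      (numSuperMultiplets N : ℚ) = 1 / (2 * (p : ℚ) * ((p : ℚ) - 1)) *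
        (1 / (4 * (p : ℚ)) * (Nat.choose (4 * p) (2 * p) : ℚ)
          + (4 * (p : ℚ) ^ 2 + 1) / (4 * (p : ℚ)) * (Nat.choose (2 * p) p : ℚ)
          + 2 * ((p : ℚ) ^ 2 - 1) / (p : ℚ)
          + (p : ℚ) * ∑ m ∈ (p - 1).divisors with m < (p - 1) / 2,
              (Nat.totient ((p - 1) / m) : ℚ) *
                ((((p : ℚ) + 4 * (m : ℚ) + 1) / (2 * (m : ℚ) + 1)
                    - (1 - (-1 : ℚ) ^ ((p - 1) / m)) / 4) * (Nat.choose (4 * m) (2 * m) : ℚ)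
                  + (1 - (-1 : ℚ) ^ ((p - 1) / m)) / 4 * (Nat.choose (2 * m) m : ℚ)))) := by
  have : NeZero p := ⟨hp.ne_zero⟩
  refine ⟨fun T hT hcyc => ?_, ?_, ?_, ?_⟩
  · rw [numSuperMultiplets_eq_div, sum_numInvariant_eq_finsum_directProd N
      (numInvariant_eq_of_zpowers_eq p hp hodd N hN) (numInvariant_of_not_isCyclic p hp hodd N hN)
      T hT hcyc]
  · rw [numSuperMultiplets_eq_div, sum_numInvariant_eq_finsum_symmGroup]
  · rintro rfl
    rw [numSuperMultiplets_eq_div, sum_numInvariant_prime N hp hodd, Nat.totient_prime hp,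
      Nat.cast_sub hp.one_le, Nat.cast_one]
  · rintro rfl
    rw [numSuperMultiplets_eq_div, sum_numInvariant_two_mul_prime p hp hodd,
      Nat.totient_mul (Nat.coprime_two_left.2 hodd), Nat.totient_two, one_mul,
      Nat.totient_prime hp, Nat.cast_sub hp.one_le, Nat.cast_one, Nat.cast_mul, Nat.cast_two]
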